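/- Let $K\ge 1$ base arms be given. For each base arm $k$ and each $x\in[0,1]$ there is an unknown reward distribution on $[0,1]$ whose mean $r_k(x)$ is Lipschitz in $x$ with constant $L_k\in(0,1]$. In each round $t=1,\dots,T$ ($T\ge 2$) the learner plays a meta arm $p(t)=(p_1(t),\dots,p_K(t))$ in the probability simplex $\mathcal P=\{p\in[0,1]^K:\sum_k p_k=1\}$. Each base arm $k$ is then activated independently with probability $p_k(t)$, and each activated arm $k$ yields an observed reward, drawn independently from its distribution at $x=p_k(t)$ (action-dependent case: the impact is $f(t)=p(t)$). The expected reward of a round in which $p$ is played is $U(p)=\sum_k p_k r_k(p_k)$, and the regret is $$\lambda(T)=\sup_{p\in\mathcal P}\sum_{t=1}^T U(p)-\mathbb E\Big[\sum_{t=1}^T U(p(t))\Big].$$ Let $1/\epsilon$ be a positive integer and $\mathcal P_\epsilon=\{p:\sum_k p_k=1,\ p_k\in\{\epsilon,2\epsilon,\dots,1\}\text{ for all }k\}$, assumed nonempty (that is, $K\epsilon\le 1$). The algorithm Action-Dependent UCB plays meta arms in $\mathcal P_\epsilon$ only. For a round $s$ let $\hat r_s(p_k(s))$ be the observed reward of arm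 $k$ divided by $p_k(s)$ if arm $k$ is activated, and $0$ otherwise. For a value $p_k\in\{\epsilon,2\epsilon,\dots,1\}$ of the $k$-th coordinate let $n_t(p_k)$ be the number of rounds $s<t$ with $p_k(s)=p_k$, and $\bar r_t(p_k)$ the average of $\hat r_s(p_k)$ over these rounds. The first $K/\epsilon$ rounds are an initialization, in which every value of every coordinate that occurs in some meta arm of $\mathcal P_\epsilon$ is included in a played meta arm at least once; the choice is otherwise arbitrary. In each round $t>K/\epsilon$ the algorithm plays a meta arm $p\in\mathcal P_\epsilon$ that maximizes $$\mathtt{UCB}_t(p)=\sqrt{\frac{K\ln t}{\min_k n_t(p_k)}}+\sum_{k=1}^K p_k\,\bar r_t(p_k),$$ with ties broken arbitrarily. Theorem. If $\epsilon=\Theta\big((\ln T/T)^{1/3}\big)$, then $\lambda(T)=O\big(K\,T^{2/3}(\ln T)^{1/3}\big)$. Precisely: for all constants $0<c_1\le c_2$ there is a constant $C>0$, depending only on $c_1$ and $c_2$, such that $c_1(\ln T/T)^{1/3}\le\epsilon\le c_2(\ln T/T)^{1/3}$ implies $\lambda(T)\le C\,K\,T^{2/3}(\ln T)^{1/3}$,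 for all $K$, $T$, $\epsilon$ and all reward distributions as above and every run of the algorithm. -/

import Mathlib

open MeasureTheory ProbabilityTheory
open scoped unitInterval NNReal

noncomputable section

namespace ActionBandit

/-- The continuous simplex of meta arms: vectors `p ∈ [0,1]^K` with `∑ k, p k = 1`. -/
abbrev Simplex (K : ℕ) : Type := {p : Fin K → I // ∑ k, (p k : ℝ) = 1}

/-- An action-dependent bandit environment with `K` base arms: when base arm `k` is activated
under a meta arm that gives it probability `x`, its reward has law `rewardLaw k x` on `[0,1]`. -/
structure Environment (K : ℕ) where
  /-- the reward distributions -/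
  rewardLaw : Fin K → I → Measure I
  isProbabilityMeasure : ∀ k x, IsProbabilityMeasure (rewardLaw k x)
  /-- the Lipschitz constants of the mean reward functions -/
  lip : Fin K → ℝ≥0
  lip_pos : ∀ k, 0 < lip k
  lip_le_one : ∀ k, lip k ≤ 1
  lipschitz : ∀ k, LipschitzWith (lip k) (fun x => ∫ y, (y : ℝ) ∂(rewardLaw k x))

/-- The mean reward function `r_k : [0,1] → [0,1]`. -/
def Environment.mean {K : ℕ} (env : Environment K) (k : Fin K) (x : I) : ℝ :=
  ∫ y, (y : ℝ) ∂(env.rewardLaw k x)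

/-- Expected reward `U(p) = ∑ k, p_k * r_k(p_k)` of one round in which `p` is played. -/
def Environment.utility {K : ℕ} (env : Environment K) (p : Fin K → I) : ℝ :=
  ∑ k, (p k : ℝ) * env.mean k (p k)

/-- The discretized simplex with mesh `ε = 1 / m`, in units of `ε`: the element `a` stands for
the meta arm with `p_k = a_k * ε`, where `p_k ∈ {ε, 2ε, …, 1}` and `∑ k, p_k = 1`. -/
abbrev GridArm (K m : ℕ) : Type := {a : Fin K → ℕ // (∀ k, 1 ≤ a k) ∧ ∑ k, a k = m}

theorem GridArm.le {K m : ℕ} (a : GridArm K m) (k : Fin K) : a.1 k ≤ m := by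
  exact (Finset.single_le_sum (fun i _ => Nat.zero_le (a.1 i)) (Finset.mem_univ k)).trans
    a.2.2.le

/-- The meta arm `p_k = a_k / m` that is represented by `a`. -/
def GridArm.prob {K m : ℕ} (a : GridArm K m) (k : Fin K) : I :=
  ⟨(a.1 k : ℝ) / m, div_nonneg (Nat.cast_nonneg _) (Nat.cast_nonneg _),
    div_le_one_of_le₀ (Nat.cast_le.mpr (a.le k)) (Nat.cast_nonneg _)⟩

/-- The outcome of one round: for each base arm, whether it is activated, and its reward. -/
abbrev Outcome (K : ℕ) : Type := Fin K → Bool × I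

/-- The law of the outcome of a round in which `a` is played: each base arm `k` is activated
independently with probability `p_k`, and has an independent reward with law `rewardLaw k p_k`. -/
def Environment.outcomeLaw {K m : ℕ} (env : Environment K) (a : GridArm K m) :
    Measure (Outcome K) :=
  Measure.pi fun k =>
    (bernoulliMeasure true false (a.prob k)).prod (env.rewardLaw k (a.prob k))

section Run

variable {K m : ℕ} {Ω : Type*} [MeasurableSpace Ω]

/-- Everything that happened in the rounds `1, …, t - 1`. -/
def history (arm : ℕ → Ω → GridArm K m) (out : ℕ → Ω → Outcome K) (t : ℕ) (ω : Ω) :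
    Finset.Ico 1 t → GridArm K m × Outcome K :=
  fun s => (arm s ω, out s ω)

/-- `arm` and `out` are the meta arms played and the outcomes in the rounds `1, …, T` of an
interaction with `env`: conditionally on the past and on `arm t = a`, the outcome of round `t` has
law `env.outcomeLaw a`. The choice of `arm t` is otherwise unrestricted. -/
structure IsInteraction (env : Environment K) (T : ℕ) (μ : Measure Ω)
    (arm : ℕ → Ω → GridArm K m) (out : ℕ → Ω → Outcome K) : Prop where
  measurable_arm : ∀ t, Measurable (arm t)
  measurable_out : ∀ t, Measurable (out t)
  law : ∀ t ∈ Finset.Icc 1 T, ∀ a : GridArm K m,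
    (μ.restrict {ω | arm t ω = a}).map (fun ω => (history arm out t ω, out t ω)) =
      ((μ.restrict {ω | arm t ω = a}).map (history arm out t)).prod (env.outcomeLaw a)

/-- The rounds before round `t` in which the meta arm contains the discretized arm
`p_k = j / m`. -/
def pullRounds (arm : ℕ → Ω → GridArm K m) (t : ℕ) (ω : Ω) (k : Fin K) (j : ℕ) : Finset ℕ :=
  {s ∈ Finset.Ico 1 t | (arm s ω).1 k = j}

/-- The number of those rounds. -/
def pulls (arm : ℕ → Ω → GridArm K m) (t : ℕ) (ω : Ω) (k : Fin K) (j : ℕ) : ℕ :=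
  (pullRounds arm t ω k j).card

/-- The importance-weighted reward of base arm `k` in a round with meta arm `a` and outcome `o`.
The reward of `k` enters only if `k` is activated. -/
def weightedReward (a : GridArm K m) (o : Outcome K) (k : Fin K) : ℝ :=
  if (o k).1 = true then ((o k).2 : ℝ) / (a.prob k : ℝ) else 0

/-- The empirical mean, before round `t`, of the importance-weighted rewards of the discretized
arm `p_k = j / m`. -/
def empMean (arm : ℕ → Ω → GridArm K m) (out : ℕ → Ω → Outcome K) (t : ℕ) (ω : Ω)
    (k : Fin K) (j : ℕ) : ℝ :=
  (∑ s ∈ pullRounds arm t ω k j, weightedReward (arm s ω) (out s ω) k) / pulls arm t ω k j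

/-- The index of the meta arm `a` at the beginning of round `t`:
`√(K ln t / min_k n(p_k)) + ∑ k, p_k * empMean(p_k)`. -/
def ucb (arm : ℕ → Ω → GridArm K m) (out : ℕ → Ω → Outcome K) (t : ℕ) (ω : Ω)
    (a : GridArm K m) : ℝ :=
  √(K * Real.log t / ((⨅ k, pulls arm t ω k (a.1 k) : ℕ) : ℝ)) +
    ∑ k, (a.prob k : ℝ) * empMean arm out t ω k (a.1 k)

/-- `arm` and `out` form a run of Action-Dependent UCB with mesh `ε = 1 / m` and horizon `T`.
The initialization takes the first `K / ε = K * m` rounds; in these every discretized arm that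
occurs in some meta arm of the discretized simplex is included at least once. Afterwards a
meta arm of largest index is played, ties being broken arbitrarily. -/
structure IsActionDependentUCB (env : Environment K) (T : ℕ) (μ : Measure Ω)
    (arm : ℕ → Ω → GridArm K m) (out : ℕ → Ω → Outcome K) : Prop
    extends IsInteraction env T μ arm out where
  initialization : K * m ≤ T → ∀ᵐ ω ∂μ, ∀ (a : GridArm K m) (k : Fin K),
    ∃ s ∈ Finset.Icc 1 (K * m), (arm s ω).1 k = a.1 k
  selection : ∀ᵐ ω ∂μ, ∀ t ∈ Finset.Icc (K * m + 1) T, ∀ a : GridArm K m,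
    ucb arm out t ω a ≤ ucb arm out t ω (arm t ω)

/-- The regret `λ(T)` against the best fixed meta arm of the continuous simplex. -/
def regret (env : Environment K) (T : ℕ) (μ : Measure Ω) (arm : ℕ → Ω → GridArm K m) : ℝ :=
  (⨆ p : Simplex K, ∑ _t ∈ Finset.Icc 1 T, env.utility p.1) -
    ∫ ω, ∑ t ∈ Finset.Icc 1 T, env.utility (arm t ω).prob ∂μ

end Run

end ActionBandit

end

noncomputable section

namespace ActionBandit


/-! For a discretized arm `p_k` pulled `n_k` times, let `w_k` be the sum of its centred collected
rewards. The importance weight cancels against `p_k`, so `p_k` times the empirical mean misses `p_k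
r_k(p_k)` by exactly `w_k / n_k`. Collected rewards lie in `[0,1]`, with mean and second moment at
most `p_k`.

Rounding a meta arm to some grid arm `b` costs at most `6K/m` per round (`exists_gridArm_near`).
After the initialization, optimism bounds the regret against `b` by the bonus of the played arm plus
its deviations `∑ w_k / n_k`, unless the index of `b` is below its utility
(`utility_sub_utility_le`). There remain three sums.

Underestimation of `b`: by Cauchy–Schwarz the total downward deviation is at most `√(Q / min n_k)`
with `Q = ∑ max(-w_k, 0)² / (p_k n_k)`, so one needs `Q ≤ K ln t`. A product over the base arms of
mixtures of exponential supermartingales dominates `exp(3Q/8 - K)`, whatever the random pull counts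
are. Markov's inequality bounds the failure probability by `(O(ln t) t^(-3/8))^K`, eventually at
most `t^(-1/3)`, which sums to `O(T^(2/3))` (`utility_le_ucb`, `measure_underestimation_le`).

Overestimation of the played arm: no concentration is needed. The potential `w² / (n + 1)` shows
that each of the `Km` discretized arms has expected weighted second moment at most `ln(T + 1)`
(`sum_lintegral_sqDeviation_le`); the inequality of arithmetic and geometric means turns this into a
bound on `∑ w_k / n_k`.

Bonuses: each round is charged to a coordinate with fewest pulls, whose capped square-root potential
grows (`sum_inv_sqrt_iInf_pulls_le`).

With `x = (ln T / T)^(1/3)`, `m` of order `1/x` and suitable parameters, every term is `O(K T x)`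
(`regret_terms_le`). -/

/-! ### Discretization and Lipschitz bounds for the utility. -/

/-- In units of the mesh the error budget is `K` for rounding, `K` for scaling `p` by `m - K`
instead of `m`, and `K` for the leftover mass. -/
theorem exists_gridArm_near {K m : ℕ} (hK : 1 ≤ K) (hKm : K ≤ m) (p : Simplex K) :
    ∃ a : GridArm K m, ∑ k, |(p.1 k : ℝ) - (a.prob k : ℝ)| ≤ 3 * K / m := by
  classical
  have hm : (0 : ℝ) < m := by exact_mod_cast (by omega : 0 < m)
  have hKm' : (0 : ℝ) ≤ (m : ℝ) - K := by
    have : (K : ℝ) ≤ m := by exact_mod_cast hKm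
    linarith
  set k₀ : Fin K := ⟨0, hK⟩
  -- The `1` keeps every coordinate positive, and the factor `m - K` reserves room for these `K`
  -- units. The leftover `r` is then between `0` and `K` and goes to one coordinate.
  set b : Fin K → ℕ := fun k => 1 + ⌊((m : ℝ) - K) * p.1 k⌋₊ with hb
  have hfl : ∀ k, (0 : ℝ) ≤ ((m : ℝ) - K) * p.1 k := fun k => mul_nonneg hKm' (p.1 k).2.1
  have hb_le : ∀ k, (b k : ℝ) ≤ 1 + ((m : ℝ) - K) * p.1 k := fun k => by
    have := Nat.floor_le (hfl k)
    simp only [hb]; push_cast; linarith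
  have hb_gt : ∀ k, ((m : ℝ) - K) * p.1 k < (b k : ℝ) := fun k => by
    have := Nat.lt_floor_add_one (((m : ℝ) - K) * p.1 k)
    simp only [hb]; push_cast; linarith
  have hp : ∑ k, (p.1 k : ℝ) = 1 := p.2
  have hsum_le : ∑ k, b k ≤ m := by
    have : ∑ k, (b k : ℝ) ≤ ∑ k, (1 + ((m : ℝ) - K) * p.1 k) :=
      Finset.sum_le_sum fun k _ => hb_le k
    rw [Finset.sum_add_distrib, ← Finset.mul_sum, hp] at this
    simp at this
    exact_mod_cast this
  have hsum_ge : (m : ℝ) - K ≤ ∑ k, (b k : ℝ) := by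
    have : ∑ k, ((m : ℝ) - K) * p.1 k ≤ ∑ k, (b k : ℝ) :=
      Finset.sum_le_sum fun k _ => (hb_gt k).le
    rwa [← Finset.mul_sum, hp, mul_one] at this
  set r : ℕ := m - ∑ k, b k with hr
  have hrK : (r : ℝ) ≤ K := by
    rw [hr, Nat.cast_sub hsum_le]; push_cast; linarith
  refine ⟨⟨fun k => b k + if k = k₀ then r else 0, fun k => ?_, ?_⟩, ?_⟩
  · simp only [hb]; omega
  · rw [Finset.sum_add_distrib, Finset.sum_ite_eq' Finset.univ k₀]
    simp only [Finset.mem_univ, if_true]; omega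
  · have key : ∀ k, |(p.1 k : ℝ) - ((b k + if k = k₀ then r else 0 : ℕ) : ℝ) / m| ≤
        (1 + K * p.1 k + if k = k₀ then (r : ℝ) else 0) / m := fun k => by
      rw [le_div_iff₀ hm, ← abs_of_pos hm, ← abs_mul, abs_of_pos hm, sub_mul,
        div_mul_cancel₀ _ hm.ne']
      have h1 := hb_le k
      have h2 := hb_gt k
      have h3 : (0 : ℝ) ≤ K * p.1 k := mul_nonneg (Nat.cast_nonneg _) (p.1 k).2.1
      push_cast
      have h4 : (0 : ℝ) ≤ if k = k₀ then (r : ℝ) else 0 := by split_ifs <;> positivity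
      rw [abs_le]
      constructor <;> nlinarith
    refine (Finset.sum_le_sum fun k _ => key k).trans ?_
    rw [← Finset.sum_div, Finset.sum_add_distrib, Finset.sum_add_distrib, ← Finset.mul_sum, hp,
      Finset.sum_ite_eq' Finset.univ k₀]
    simp only [Finset.mem_univ, if_true, Finset.sum_const, Finset.card_univ, Fintype.card_fin,
      nsmul_eq_mul, mul_one]
    gcongr
    linarith

section Environment

variable {K m : ℕ} (env : Environment K)

theorem Environment.mean_nonneg (k : Fin K) (x : I) : 0 ≤ env.mean k x :=
  integral_nonneg fun y => y.2.1

theorem Environment.integrable_coe (k : Fin K) (x : I) :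
    Integrable (fun y : I => (y : ℝ)) (env.rewardLaw k x) := by
  have := env.isProbabilityMeasure k x
  exact Integrable.of_bound (C := 1) measurable_subtype_coe.aestronglyMeasurable
    (ae_of_all _ fun y => by rw [Real.norm_of_nonneg y.2.1]; exact y.2.2)

theorem Environment.mean_le_one (k : Fin K) (x : I) : env.mean k x ≤ 1 := by
  have := env.isProbabilityMeasure k x
  calc env.mean k x ≤ ∫ _, (1 : ℝ) ∂(env.rewardLaw k x) :=
        integral_mono (env.integrable_coe k x) (integrable_const _) fun y => y.2.2
    _ = 1 := by simp

theorem Environment.abs_mean_sub_le (k : Fin K) (x y : I) :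
    |env.mean k x - env.mean k y| ≤ |(x : ℝ) - y| := by
  have h := (env.lipschitz k).dist_le_mul x y
  rw [Real.dist_eq, Subtype.dist_eq, Real.dist_eq] at h
  exact h.trans (mul_le_of_le_one_left (abs_nonneg _) (by exact_mod_cast env.lip_le_one k))

theorem Environment.utility_nonneg (p : Fin K → I) : 0 ≤ env.utility p :=
  Finset.sum_nonneg fun k _ => mul_nonneg (p k).2.1 (env.mean_nonneg k _)

theorem Environment.utility_le_one (p : Fin K → I) (hp : ∑ k, (p k : ℝ) = 1) :
    env.utility p ≤ 1 :=
  hp ▸ Finset.sum_le_sum fun k _ => mul_le_of_le_one_right (p k).2.1 (env.mean_le_one k _)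

/-- Each summand is a product of two functions that are bounded by `1` and `1`-Lipschitz, hence the
factor `2`. -/
theorem Environment.utility_sub_le (p q : Fin K → I) :
    env.utility p - env.utility q ≤ 2 * ∑ k, |(p k : ℝ) - q k| := by
  rw [Environment.utility, Environment.utility, ← Finset.sum_sub_distrib, Finset.mul_sum]
  refine Finset.sum_le_sum fun k _ => ?_
  have h1 := env.abs_mean_sub_le k (p k) (q k)
  have h2 := le_abs_self ((p k : ℝ) - q k)
  have h3 := (le_abs_self _).trans h1
  have h4 := (p k).2.1
  have h5 := (p k).2.2
  have h6 := env.mean_nonneg k (q k)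
  have h7 := env.mean_le_one k (q k)
  have h8 := abs_nonneg ((p k : ℝ) - q k)
  have e1 : (p k : ℝ) * (env.mean k (p k) - env.mean k (q k)) ≤ |(p k : ℝ) - q k| :=
    (mul_le_mul_of_nonneg_left h3 h4).trans (mul_le_of_le_one_left h8 h5)
  have e2 : ((p k : ℝ) - q k) * env.mean k (q k) ≤ |(p k : ℝ) - q k| :=
    (mul_le_mul_of_nonneg_right h2 h6).trans (mul_le_of_le_one_right h8 h7)
  linarith

theorem GridArm.pos (a : GridArm K m) (k : Fin K) : 0 < m := (a.2.1 k).trans (a.le k)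

theorem GridArm.prob_pos (a : GridArm K m) (k : Fin K) : (0 : ℝ) < a.prob k :=
  div_pos (by exact_mod_cast a.2.1 k) (by exact_mod_cast a.pos k)

theorem GridArm.sum_prob (hm : 0 < m) (a : GridArm K m) : ∑ k, (a.prob k : ℝ) = 1 := by
  have : ∑ k, (a.1 k : ℝ) = m := by exact_mod_cast a.2.2
  simp only [GridArm.prob]
  rw [← Finset.sum_div, this, div_self (by exact_mod_cast hm.ne')]

theorem GridArm.prob_congr {a b : GridArm K m} {k : Fin K} (h : a.1 k = b.1 k) :
    a.prob k = b.prob k := by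
  simp only [GridArm.prob, h]

end Environment

/-! ### Deterministic inequalities: mixtures, potentials and sums of powers. -/

/-- A dyadic mixture of exponential tilts, which dominates the optimal tilt up to the factor
`3 / 4` in the exponent as long as the optimal parameter is between `2⁻ᴸ` and `1`. -/
def dyadicMixture (L : ℕ) (p : ℝ) (n : ℕ) (d : ℝ) : ℝ :=
  1 + ∑ i ∈ Finset.range (L + 1), Real.exp ((1 / 2) ^ i * d - ((1 / 2) ^ i) ^ 2 * (p * n) / 2)

theorem dyadicMixture_nonneg (L : ℕ) (p : ℝ) (n : ℕ) (d : ℝ) : 0 ≤ dyadicMixture L p n d :=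
  add_nonneg zero_le_one (Finset.sum_nonneg fun _ _ => (Real.exp_pos _).le)

/-- The optimal tilt is `l = max d 0 / (p n)`, at most `1` by `hd`. A dyadic tilt in `[l/2, l]`
loses only the factor `3/4` in the exponent; if `l` is below all dyadic tilts, the constant summand
suffices thanks to the slack `-1`. -/
theorem exp_le_dyadicMixture {L n : ℕ} {p d : ℝ} (hp : 0 < p) (hp1 : p ≤ 1) (hn : 1 ≤ n)
    (hnL : n ≤ 4 ^ L) (hd : d ≤ p * n) :
    Real.exp (3 / 8 * (max d 0 ^ 2 / (p * n)) - 1) ≤ dyadicMixture L p n d := by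
  have hn0 : (0 : ℝ) < n := by exact_mod_cast hn
  have hV : 0 < p * n := by positivity
  set V := p * n with hVdef
  set l := max d 0 / V with hl
  have hl0 : 0 ≤ l := by positivity
  have hl1 : l ≤ 1 := by
    rw [hl, div_le_one hV]; exact max_le hd hV.le
  have hlV : max d 0 = l * V := by rw [hl]; field_simp
  have hQ : max d 0 ^ 2 / V = l ^ 2 * V := by rw [hlV]; field_simp
  rw [hQ]
  have hsum0 : ∀ i ∈ Finset.range (L + 1),
      0 ≤ Real.exp ((1 / 2 : ℝ) ^ i * d - ((1 / 2 : ℝ) ^ i) ^ 2 * (p * n) / 2) :=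
    fun _ _ => (Real.exp_pos _).le
  by_cases hsmall : l < (1 / 2) ^ L
  -- This is where `n ≤ 4 ^ L` enters: it makes the finest tilt small enough.
  · have h1 : l ^ 2 * V ≤ 1 := by
      have hnL' : (n : ℝ) ≤ 4 ^ L := by exact_mod_cast hnL
      have : l ^ 2 ≤ ((1 / 2) ^ L) ^ 2 := pow_le_pow_left₀ hl0 hsmall.le 2
      have e : ((1 / 2 : ℝ) ^ L) ^ 2 * 4 ^ L = 1 := by
        rw [← pow_mul, mul_comm L 2, pow_mul, ← mul_pow]; norm_num
      calc l ^ 2 * V ≤ ((1 / 2) ^ L) ^ 2 * 4 ^ L := by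
            refine mul_le_mul this ?_ hV.le (by positivity)
            exact (mul_le_of_le_one_left hn0.le hp1).trans hnL'
        _ = 1 := e
    have : Real.exp (3 / 8 * (l ^ 2 * V) - 1) ≤ 1 := Real.exp_le_one_iff.mpr (by linarith)
    exact this.trans (le_add_of_nonneg_right (Finset.sum_nonneg hsum0))
  · push Not at hsmall
    have hex : ∃ i, (1 / 2 : ℝ) ^ i ≤ l := ⟨L, hsmall⟩
    classical
    -- The largest dyadic tilt not exceeding `l`; for `i = 0` the bound `l ≤ 2 * (1 / 2) ^ i` comes
    -- from `l ≤ 1`.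
    set i := Nat.find hex
    have hi : (1 / 2 : ℝ) ^ i ≤ l := Nat.find_spec hex
    have hiL : i ≤ L := Nat.find_min' hex hsmall
    have hi2 : l ≤ 2 * (1 / 2 : ℝ) ^ i := by
      rcases Nat.eq_zero_or_pos i with h0 | h0
      · rw [h0]; linarith
      · have hlt : l < (1 / 2 : ℝ) ^ (i - 1) := by
          have := Nat.find_min hex (Nat.sub_lt h0 one_pos)
          push Not at this
          exact this
        obtain ⟨j, hj⟩ : ∃ j, i = j + 1 := ⟨i - 1, by omega⟩
        have h3 : (1 / 2 : ℝ) ^ (i - 1) = 2 * (1 / 2) ^ i := by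
          rw [hj, Nat.add_sub_cancel, pow_succ]; ring
        linarith
    have hipos : (0 : ℝ) < (1 / 2 : ℝ) ^ i := by positivity
    have hdV : d = l * V := by
      rcases le_total d 0 with h | h
      · rw [max_eq_right h] at hlV
        nlinarith [mul_pos (hipos.trans_le hi) hV]
      · rw [← hlV, max_eq_left h]
    refine (Real.exp_le_exp.mpr ?_).trans ((Finset.single_le_sum hsum0
      (Finset.mem_range.mpr (Nat.lt_succ_of_le hiL))).trans (le_add_of_nonneg_left zero_le_one))
    rw [← hVdef, hdV]
    -- The function `θ l - θ² / 2` increases up to `θ = l` and equals `3 l² / 8` at `θ = l / 2`.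
    have : 3 / 8 * l ^ 2 ≤ (1 / 2 : ℝ) ^ i * l - ((1 / 2 : ℝ) ^ i) ^ 2 / 2 := by
      nlinarith
    nlinarith

/-- Below the cap `1 / b` the growth of the square root pays: `√(n+1) - √n ≥ 1 / (3√n)`. Above it,
`√(n+1) ≤ 2√n` makes `1/√n` at most `2b`. -/
theorem inv_sqrt_le_potential {b : ℝ} (hb : 0 < b) {n : ℕ} (hn : 1 ≤ n) :
    1 / √(n : ℝ) ≤ 2 * b + (4 * min √((n : ℝ) + 1) (1 / b) - 4 * min √(n : ℝ) (1 / b)) := by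
  have hn1 : (1 : ℝ) ≤ n := by exact_mod_cast hn
  set x := √(n : ℝ)
  set y := √((n : ℝ) + 1)
  have hx1 : 1 ≤ x := Real.one_le_sqrt.mpr hn1
  have hx : x ^ 2 = n := Real.sq_sqrt (by linarith)
  have hy : y ^ 2 = n + 1 := Real.sq_sqrt (by linarith)
  have hxy : x ≤ y := Real.sqrt_le_sqrt (by linarith)
  have hy2 : y ≤ 2 * x := by nlinarith
  have hx0 : 0 < x := by linarith
  rcases le_total y (1 / b) with h | h
  · rw [min_eq_left h, min_eq_left (hxy.trans h), div_le_iff₀ hx0]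
    have h1 : (y - x) * (y + x) = 1 := by nlinarith
    have h2 : 1 ≤ (y - x) * (3 * x) := by nlinarith
    nlinarith [mul_pos hb hx0]
  · have h1 : 1 / x ≤ 2 * b := by
      rw [div_le_iff₀ hb] at h
      rw [div_le_iff₀ hx0]
      nlinarith
    have h2 : min x (1 / b) ≤ min y (1 / b) := min_le_min_right _ hxy
    linarith

/-- Bernoulli's inequality for `(1 - 1/x)^(2/3)` gives `x^(2/3) - (x-1)^(2/3) ≥ (2/3) x^(-1/3)`. -/
theorem sum_rpow_neg_third_le (T : ℕ) :
    ∑ t ∈ Finset.Icc 1 T, (t : ℝ) ^ (-(1 / 3) : ℝ) ≤ 2 * (T : ℝ) ^ (2 / 3 : ℝ) := by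
  induction T with
  | zero => simp
  | succ n ih =>
    rw [Finset.sum_Icc_succ_top (by omega)]
    have hx : (0 : ℝ) < ((n + 1 : ℕ) : ℝ) := by positivity
    have hx1 : (1 : ℝ) ≤ ((n + 1 : ℕ) : ℝ) := by exact_mod_cast Nat.succ_pos n
    have hn : (n : ℝ) = ((n + 1 : ℕ) : ℝ) - 1 := by push_cast; ring
    set x : ℝ := ((n + 1 : ℕ) : ℝ)
    have hinv : 1 / x ≤ 1 := by rw [div_le_one hx]; exact hx1
    have h1 := rpow_one_add_le_one_add_mul_self (s := -(1 / x)) (by linarith)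
      (p := 2 / 3) (by norm_num) (by norm_num)
    have h2 : (n : ℝ) ^ (2 / 3 : ℝ) = x ^ (2 / 3 : ℝ) * (1 + -(1 / x)) ^ (2 / 3 : ℝ) := by
      rw [← Real.mul_rpow hx.le (by linarith), hn]
      congr 1
      field_simp
      ring
    have h3 : x ^ (-(1 / 3) : ℝ) = x ^ (2 / 3 : ℝ) * (1 / x) := by
      rw [one_div x, ← Real.rpow_neg_one x, ← Real.rpow_add hx]
      norm_num
    have h4 : 0 < x ^ (2 / 3 : ℝ) := by positivity
    have h5 := mul_le_mul_of_nonneg_left h1 h4.le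
    rw [← h2] at h5
    have h6 : 0 < x ^ (2 / 3 : ℝ) * (1 / x) := by positivity
    rw [h3]
    nlinarith

/-- Since `3/8 - 1/3 = 1/24`, a power `t^(1/24)` is left to absorb the logarithmic number of tilts.
-/
theorem exists_clog_mul_rpow_le :
    ∃ t₀ : ℕ, ∀ t : ℕ, t₀ ≤ t → 1 ≤ t ∧
      ((Nat.clog 4 t : ℝ) + 2) * (Real.exp 1 * (t : ℝ) ^ (-(3 / 8) : ℝ)) ≤
        (t : ℝ) ^ (-(1 / 3) : ℝ) := by
  have h := (isLittleO_log_rpow_atTop (r := 1 / 24) (by norm_num)).bound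
    (c := 1 / (4 * Real.exp 1)) (by positivity)
  have h2 := (Real.tendsto_log_atTop).eventually_ge_atTop 1
  have h3 := (h.and h2).and (Filter.eventually_ge_atTop 1)
  obtain ⟨t₀, ht₀⟩ := Filter.eventually_atTop.mp
    (tendsto_natCast_atTop_atTop.eventually h3)
  refine ⟨t₀, fun t ht => ?_⟩
  obtain ⟨⟨ha, hb⟩, hc⟩ := ht₀ t ht
  have ht1 : 1 ≤ t := by exact_mod_cast hc
  have htpos : (0 : ℝ) < t := by linarith
  refine ⟨ht1, ?_⟩
  rw [Real.norm_of_nonneg (by linarith), Real.norm_of_nonneg (by positivity)] at ha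
  have hclog : (Nat.clog 4 t : ℝ) ≤ Real.log t + 1 := by
    have h4 : (1 : ℝ) ≤ Real.log 4 := by
      rw [Real.le_log_iff_exp_le (by norm_num)]
      linarith [Real.exp_one_lt_d9]
    have h0 : 0 ≤ Real.logb 4 t := Real.logb_nonneg (by norm_num) hc
    have : (Nat.clog 4 t : ℝ) < Real.logb 4 t + 1 := by
      rw [← Real.natCeil_logb_natCast]
      exact_mod_cast Nat.ceil_lt_add_one h0
    have h5 : Real.logb 4 t ≤ Real.log t := by
      rw [Real.logb]
      exact div_le_self (by linarith) h4
    linarith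
  have e : (t : ℝ) ^ (-(1 / 3) : ℝ) = (t : ℝ) ^ (1 / 24 : ℝ) * (t : ℝ) ^ (-(3 / 8) : ℝ) := by
    rw [← Real.rpow_add htpos]; norm_num
  rw [e, ← mul_assoc]
  refine mul_le_mul_of_nonneg_right ?_ (by positivity)
  have h6 : 4 * Real.log t * Real.exp 1 ≤ (t : ℝ) ^ (1 / 24 : ℝ) := by
    have := mul_le_mul_of_nonneg_left ha (by positivity : 0 ≤ 4 * Real.exp 1)
    calc _ = 4 * Real.exp 1 * Real.log t := by ring
      _ ≤ _ := this
      _ = _ := by field_simp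
  refine le_trans (mul_le_mul_of_nonneg_right ?_ (Real.exp_pos 1).le) h6
  linarith


/-! ### Moments and exponential moments of a single round. -/

/-- The reward collected from a base arm, which is `0` unless the arm is activated. -/
def reward (z : Bool × I) : ℝ := if z.1 = true then (z.2 : ℝ) else 0

theorem measurable_reward : Measurable reward :=
  Measurable.ite (measurable_fst (measurableSet_singleton true))
    (measurable_subtype_coe.comp measurable_snd) measurable_const

theorem reward_nonneg (z : Bool × I) : 0 ≤ reward z := by
  unfold reward; split_ifs
  exacts [z.2.2.1, le_rfl]

theorem reward_le_one (z : Bool × I) : reward z ≤ 1 := by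
  unfold reward; split_ifs
  exacts [z.2.2.2, zero_le_one]

section Round

variable {K m : ℕ} (env : Environment K) (a : GridArm K m) (k : Fin K)

/-- The expected contribution `p_k * r_k(p_k)` of base arm `k` to a round with meta arm `a`. -/
def expectedReward : ℝ := (a.prob k : ℝ) * env.mean k (a.prob k)

/-- The law of the activation and the reward of base arm `k`. -/
def armLaw : Measure (Bool × I) :=
  (bernoulliMeasure true false (a.prob k)).prod (env.rewardLaw k (a.prob k))

instance : IsProbabilityMeasure (armLaw env a k) := by
  have := env.isProbabilityMeasure k (a.prob k)
  unfold armLaw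
  infer_instance

instance : IsProbabilityMeasure (env.outcomeLaw a) :=
  inferInstanceAs (IsProbabilityMeasure (Measure.pi fun k => armLaw env a k))

theorem outcomeLaw_eq : env.outcomeLaw a = Measure.pi fun k => armLaw env a k := rfl

theorem integrable_of_reward {X : Type*} [MeasurableSpace X] (ν : Measure X) [IsFiniteMeasure ν]
    {g : ℝ → ℝ} (hg : Continuous g) {z : X → Bool × I} (hz : Measurable z) :
    Integrable (fun x => g (reward (z x))) ν := by
  obtain ⟨C, hC⟩ := (isCompact_Icc (a := (0 : ℝ)) (b := 1)).exists_bound_of_continuousOn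
    hg.continuousOn
  exact Integrable.of_bound
    (hg.measurable.comp (measurable_reward.comp hz)).aestronglyMeasurable C
    (ae_of_all _ fun x => hC _ ⟨reward_nonneg _, reward_le_one _⟩)

theorem integral_reward : ∫ z, reward z ∂(armLaw env a k) = expectedReward env a k := by
  have := env.isProbabilityMeasure k (a.prob k)
  have h : ∀ z : Bool × I, reward z = (if z.1 = true then (1 : ℝ) else 0) * (z.2 : ℝ) := fun z => by
    unfold reward; split_ifs <;> simp
  simp_rw [h]
  rw [armLaw, integral_prod_mul (fun b : Bool => if b = true then (1 : ℝ) else 0)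
    (fun y : I => (y : ℝ)), integral_bernoulliMeasure]
  simp [expectedReward, Environment.mean]

theorem expectedReward_nonneg : 0 ≤ expectedReward env a k :=
  mul_nonneg (a.prob k).2.1 (env.mean_nonneg k _)

theorem expectedReward_le_prob : expectedReward env a k ≤ a.prob k :=
  mul_le_of_le_one_right (a.prob k).2.1 (env.mean_le_one k _)

theorem expectedReward_le_one : expectedReward env a k ≤ 1 :=
  (expectedReward_le_prob env a k).trans (a.prob k).2.2

theorem expectedReward_congr {a b : GridArm K m} {k : Fin K} (h : a.1 k = b.1 k) :
    expectedReward env a k = expectedReward env b k := by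
  simp only [expectedReward, GridArm.prob_congr h]

/-- Uses `(1 + x + x²/2)(1 - x + x²/2) = 1 + x⁴/4 ≥ 1`. -/
theorem exp_neg_le_quadratic {x : ℝ} (hx : 0 ≤ x) : Real.exp (-x) ≤ 1 - x + x ^ 2 / 2 := by
  have h := Real.quadratic_le_exp_of_nonneg hx
  rw [Real.exp_neg, inv_le_iff_one_le_mul₀ (Real.exp_pos x)]
  have h1 : 0 < 1 - x + x ^ 2 / 2 := by nlinarith [sq_nonneg (x - 1)]
  nlinarith [mul_le_mul_of_nonneg_left h h1.le, sq_nonneg (x ^ 2)]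

/-- Only downward deviations are tilted, so the quadratic bound for `exp (-x)` holds for every `l ≥
0`. With `reward² ≤ reward` the variance proxy becomes the mean, hence at most `p_k`; this factor
`p_k` is what the later Cauchy–Schwarz step needs. -/
theorem integral_exp_le {l : ℝ} (hl : 0 ≤ l) :
    ∫ z, Real.exp (l * (expectedReward env a k - reward z) - l ^ 2 * (a.prob k : ℝ) / 2)
      ∂(armLaw env a k) ≤ 1 := by
  set v := expectedReward env a k
  set p : ℝ := ((a.prob k : I) : ℝ) with hp
  have hvp : v ≤ p := expectedReward_le_prob env a k
  have hpt : ∀ z : Bool × I, Real.exp (l * (v - reward z) - l ^ 2 * p / 2) ≤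
      Real.exp (l * v - l ^ 2 * p / 2) * (1 - (l - l ^ 2 / 2) * reward z) := fun z => by
    have e : l * (v - reward z) - l ^ 2 * p / 2 = (l * v - l ^ 2 * p / 2) + -(l * reward z) := by
      ring
    rw [e, Real.exp_add]
    refine mul_le_mul_of_nonneg_left
      ((exp_neg_le_quadratic (mul_nonneg hl (reward_nonneg z))).trans ?_) (Real.exp_pos _).le
    have : reward z ^ 2 ≤ reward z := by
      nlinarith [reward_nonneg z, reward_le_one z]
    nlinarith [mul_le_mul_of_nonneg_left this (sq_nonneg l)]
  have hint : Integrable reward (armLaw env a k) :=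
    integrable_of_reward _ continuous_id measurable_id
  calc _ ≤ ∫ z, Real.exp (l * v - l ^ 2 * p / 2) * (1 - (l - l ^ 2 / 2) * reward z)
        ∂(armLaw env a k) :=
        integral_mono (integrable_of_reward (armLaw env a k)
          (g := fun y => Real.exp (l * (v - y) - l ^ 2 * p / 2)) (by fun_prop) measurable_id)
          (((integrable_const _).sub (hint.const_mul _)).const_mul _) hpt
    _ = Real.exp (l * v - l ^ 2 * p / 2) * (1 - (l - l ^ 2 / 2) * v) := by
        rw [integral_const_mul, integral_sub (integrable_const _) (hint.const_mul _),
          integral_const_mul, integral_reward]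
        simp [v]
    _ ≤ Real.exp (l * v - l ^ 2 * p / 2) * Real.exp (-(l * v - l ^ 2 * p / 2)) := by
        refine mul_le_mul_of_nonneg_left ?_ (Real.exp_pos _).le
        have := Real.add_one_le_exp (-(l * v - l ^ 2 * p / 2))
        nlinarith [mul_le_mul_of_nonneg_left hvp (sq_nonneg l)]
    _ = 1 := by rw [← Real.exp_add]; simp

theorem integral_dyadicMixture_le (L n : ℕ) (d : ℝ) :
    ∫ z, dyadicMixture L (a.prob k) (n + 1) (d + (expectedReward env a k - reward z))
      ∂(armLaw env a k) ≤ dyadicMixture L (a.prob k) n d := by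
  have hint : ∀ i, Integrable (fun z => Real.exp ((1 / 2 : ℝ) ^ i *
      (d + (expectedReward env a k - reward z)) -
      ((1 / 2 : ℝ) ^ i) ^ 2 * ((a.prob k : ℝ) * ((n + 1 : ℕ) : ℝ)) / 2)) (armLaw env a k) :=
    fun i => integrable_of_reward (armLaw env a k) (g := fun y => Real.exp ((1 / 2 : ℝ) ^ i *
      (d + (expectedReward env a k - y)) -
      ((1 / 2 : ℝ) ^ i) ^ 2 * ((a.prob k : ℝ) * ((n + 1 : ℕ) : ℝ)) / 2)) (by fun_prop)
      measurable_id
  unfold dyadicMixture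
  rw [integral_add (integrable_const _) (integrable_finsetSum _ fun i _ => hint i),
    integral_finsetSum _ fun i _ => hint i]
  simp only [integral_const, probReal_univ, smul_eq_mul, mul_one]
  gcongr with i _
  have e : ∀ z, Real.exp ((1 / 2 : ℝ) ^ i * (d + (expectedReward env a k - reward z)) -
      ((1 / 2 : ℝ) ^ i) ^ 2 * ((a.prob k : ℝ) * ((n + 1 : ℕ) : ℝ)) / 2) =
      Real.exp ((1 / 2 : ℝ) ^ i * d - ((1 / 2 : ℝ) ^ i) ^ 2 * ((a.prob k : ℝ) * n) / 2) *
      Real.exp ((1 / 2 : ℝ) ^ i * (expectedReward env a k - reward z) -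
        ((1 / 2 : ℝ) ^ i) ^ 2 * (a.prob k : ℝ) / 2) := fun z => by
    rw [← Real.exp_add]; push_cast; congr 1; ring
  simp_rw [e]
  rw [integral_const_mul]
  exact mul_le_of_le_one_right (Real.exp_pos _).le (integral_exp_le env a k (by positivity))

/-- The cross term is centred, and the square of the increment is at most `1`. -/
theorem integral_sq_add_le (w : ℝ) :
    ∫ o, (w + (reward (o k) - expectedReward env a k)) ^ 2 ∂(env.outcomeLaw a) ≤ w ^ 2 + 1 := by
  set v := expectedReward env a k with hv
  have h0 := expectedReward_nonneg env a k
  have h1 := expectedReward_le_one env a k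
  have hint : Integrable (fun o : Outcome K => reward (o k)) (env.outcomeLaw a) :=
    integrable_of_reward _ continuous_id (measurable_pi_apply k)
  have hpt : ∀ o : Outcome K, (w + (reward (o k) - v)) ^ 2 ≤
      (w ^ 2 + 1) + 2 * w * (reward (o k) - v) := fun o => by
    have := reward_nonneg (o k)
    have := reward_le_one (o k)
    nlinarith
  calc _ ≤ ∫ o, ((w ^ 2 + 1) + 2 * w * (reward (o k) - v)) ∂(env.outcomeLaw a) :=
        integral_mono (integrable_of_reward (env.outcomeLaw a)
          (g := fun y => (w + (y - v)) ^ 2) (by fun_prop) (measurable_pi_apply k))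
          ((integrable_const _).add ((hint.sub (integrable_const _)).const_mul _)) hpt
    _ = w ^ 2 + 1 := by
        have e : ∫ o, reward (o k) ∂(env.outcomeLaw a) = v := by
          rw [hv, ← integral_reward env a k, outcomeLaw_eq]
          exact integral_comp_eval (measurable_reward.aestronglyMeasurable)
        have hi : Integrable (fun o : Outcome K => reward (o k) - v) (env.outcomeLaw a) :=
          hint.sub (integrable_const _)
        rw [integral_add (integrable_const _) (hi.const_mul _),
          integral_const_mul, integral_sub hint (integrable_const _), e]
        simp

end Round

/-! ### Integrating one-round inequalities along the interaction. -/

section Cumulative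

variable {K m : ℕ} {Ω E : Type*} [AddCommMonoid E]

/-- The sum of the increments `φ` over the rounds before round `t`. -/
def cumulative (φ : GridArm K m → Outcome K → E) (arm : ℕ → Ω → GridArm K m)
    (out : ℕ → Ω → Outcome K) (t : ℕ) (ω : Ω) : E :=
  ∑ s ∈ Finset.Ico 1 t, φ (arm s ω) (out s ω)

theorem cumulative_one (φ : GridArm K m → Outcome K → E) (arm : ℕ → Ω → GridArm K m)
    (out : ℕ → Ω → Outcome K) (ω : Ω) : cumulative φ arm out 1 ω = 0 := by
  simp [cumulative]

theorem cumulative_succ (φ : GridArm K m → Outcome K → E) (arm : ℕ → Ω → GridArm K m)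
    (out : ℕ → Ω → Outcome K) {t : ℕ} (ht : 1 ≤ t) (ω : Ω) :
    cumulative φ arm out (t + 1) ω = cumulative φ arm out t ω + φ (arm t ω) (out t ω) := by
  simp [cumulative, Finset.sum_Ico_succ_top ht]

variable [MeasurableSpace Ω] [MeasurableSpace E] [MeasurableAdd₂ E]

theorem measurable_cumulative {φ : GridArm K m → Outcome K → E} (hφ : ∀ a, Measurable (φ a))
    {arm : ℕ → Ω → GridArm K m} {out : ℕ → Ω → Outcome K} (harm : ∀ t, Measurable (arm t))
    (hout : ∀ t, Measurable (out t)) (t : ℕ) : Measurable (cumulative φ arm out t) :=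
  Finset.measurable_fun_sum _ fun s _ =>
    (measurable_from_prod_countable_right (f := fun z : GridArm K m × Outcome K => φ z.1 z.2)
      hφ).comp ((harm s).prodMk (hout s))

/-- The cumulative sum is a function of the history, and on `arm t = a` the joint law of history and
outcome is a product, so Tonelli applies. -/
theorem setLIntegral_cumulative_succ {env : Environment K} {T : ℕ} {μ : Measure Ω}
    [IsFiniteMeasure μ] {arm : ℕ → Ω → GridArm K m} {out : ℕ → Ω → Outcome K}
    (hI : IsInteraction env T μ arm out) {t : ℕ} (ht : t ∈ Finset.Icc 1 T)
    {φ : GridArm K m → Outcome K → E} (hφ : ∀ a, Measurable (φ a))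
    {F : E → ENNReal} (hF : Measurable F) (a : GridArm K m) :
    ∫⁻ ω in {ω | arm t ω = a}, F (cumulative φ arm out (t + 1) ω) ∂μ =
      ∫⁻ ω in {ω | arm t ω = a}, ∫⁻ o, F (cumulative φ arm out t ω + φ a o)
        ∂(env.outcomeLaw a) ∂μ := by
  have hA : MeasurableSet {ω | arm t ω = a} := hI.measurable_arm t (measurableSet_singleton a)
  have hhist : Measurable (history arm out t) :=
    measurable_pi_lambda _ fun s => (hI.measurable_arm s).prodMk (hI.measurable_out s)
  set S : (Finset.Ico 1 t → GridArm K m × Outcome K) → E := fun h => ∑ s, φ (h s).1 (h s).2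
  have hS : Measurable S := Finset.measurable_fun_sum _ fun s _ =>
    (measurable_from_prod_countable_right (f := fun z : GridArm K m × Outcome K => φ z.1 z.2)
      hφ).comp (measurable_pi_apply s)
  have hcum : ∀ ω, cumulative φ arm out t ω = S (history arm out t ω) := fun ω =>
    (Finset.sum_coe_sort (Finset.Ico 1 t) fun s => φ (arm s ω) (out s ω)).symm
  have hG : Measurable fun z : (Finset.Ico 1 t → GridArm K m × Outcome K) × Outcome K =>
      F (S z.1 + φ a z.2) :=
    hF.comp ((hS.comp measurable_fst).add ((hφ a).comp measurable_snd))
  have h1 : ∫⁻ ω in {ω | arm t ω = a}, F (cumulative φ arm out (t + 1) ω) ∂μ =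
      ∫⁻ ω in {ω | arm t ω = a}, F (S (history arm out t ω) + φ a (out t ω)) ∂μ := by
    refine setLIntegral_congr_fun hA fun ω hω => ?_
    have hω' : arm t ω = a := hω
    simp only [cumulative_succ φ arm out (Finset.mem_Icc.mp ht).1, hcum, hω']
  rw [h1, ← lintegral_map (μ := μ.restrict {ω | arm t ω = a}) hG
    (hhist.prodMk (hI.measurable_out t)), hI.law t ht a,
    lintegral_prod _ hG.aemeasurable, lintegral_map hG.lintegral_prod_right' hhist]
  simp only [hcum]

/-- One round of a potential argument: an inequality for the conditional expectation of the
potential `F` integrates over the interaction. -/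
theorem lintegral_cumulative_succ_add_le {env : Environment K} {T : ℕ} {μ : Measure Ω}
    [IsFiniteMeasure μ] {arm : ℕ → Ω → GridArm K m} {out : ℕ → Ω → Outcome K}
    (hI : IsInteraction env T μ arm out) {t : ℕ} (ht : t ∈ Finset.Icc 1 T)
    {φ : GridArm K m → Outcome K → E} (hφ : ∀ a, Measurable (φ a))
    {F : E → ENNReal} (hF : Measurable F) {G H : GridArm K m → E → ENNReal}
    (hG : ∀ a, Measurable (G a))
    (h : ∀ a x, ∫⁻ o, F (x + φ a o) ∂(env.outcomeLaw a) + G a x ≤ F x + H a x) :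
    ∫⁻ ω, F (cumulative φ arm out (t + 1) ω) ∂μ +
        ∫⁻ ω, G (arm t ω) (cumulative φ arm out t ω) ∂μ ≤
      ∫⁻ ω, (F (cumulative φ arm out t ω) + H (arm t ω) (cumulative φ arm out t ω)) ∂μ := by
  have hc := measurable_cumulative hφ hI.measurable_arm hI.measurable_out t
  have hA : ∀ a, MeasurableSet {ω | arm t ω = a} := fun a =>
    hI.measurable_arm t (measurableSet_singleton a)
  have hU : (⋃ a, {ω | arm t ω = a}) = Set.univ := by ext; simp
  have hD : Pairwise (Function.onFun Disjoint fun a => {ω | arm t ω = a}) := fun a b hab =>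
    Set.disjoint_left.mpr fun ω (h1 : arm t ω = a) (h2 : arm t ω = b) => hab (h1.symm.trans h2)
  have hsplit : ∀ f : Ω → ENNReal, ∫⁻ ω, f ω ∂μ = ∑' a, ∫⁻ ω in {ω | arm t ω = a}, f ω ∂μ :=
    fun f => by rw [← lintegral_iUnion hA hD, hU, setLIntegral_univ]
  rw [hsplit, hsplit fun ω => G _ _, hsplit fun ω => F _ + _, ← ENNReal.tsum_add]
  refine ENNReal.tsum_le_tsum fun a => ?_
  rw [setLIntegral_cumulative_succ hI ht hφ hF a]
  have e : ∫⁻ ω in {ω | arm t ω = a}, G (arm t ω) (cumulative φ arm out t ω) ∂μ =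
      ∫⁻ ω in {ω | arm t ω = a}, G a (cumulative φ arm out t ω) ∂μ :=
    setLIntegral_congr_fun (hA a) fun ω (hω : arm t ω = a) => by simp only [hω]
  rw [e, ← lintegral_add_right _ (show Measurable fun ω => G a (cumulative φ arm out t ω) from
    (hG a).comp hc)]
  refine setLIntegral_mono' (hA a) fun ω (hω : arm t ω = a) => ?_
  rw [hω]
  exact h a _

end Cumulative


section Telescope

variable {K m : ℕ} {Ω E : Type*} [MeasurableSpace Ω] [AddCommMonoid E] [MeasurableSpace E]
  [MeasurableAdd₂ E]

/-- `G` is the gain to be bounded and `H` the allowed drift of the potential `F`. It serves both the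
second-moment bound and, with `G = H = 0`, the supermartingale bound; values in `ENNReal` spare
integrability conditions. -/
theorem lintegral_cumulative_add_sum_le {env : Environment K} {T : ℕ} {μ : Measure Ω}
    [IsProbabilityMeasure μ] {arm : ℕ → Ω → GridArm K m} {out : ℕ → Ω → Outcome K}
    (hI : IsInteraction env T μ arm out)
    {φ : GridArm K m → Outcome K → E} (hφ : ∀ a, Measurable (φ a))
    {F : E → ENNReal} (hF : Measurable F) {G H : GridArm K m → E → ENNReal}
    (hG : ∀ a, Measurable (G a))
    (h : ∀ a x, ∫⁻ o, F (x + φ a o) ∂(env.outcomeLaw a) + G a x ≤ F x + H a x)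
    {N : ℕ} (hN : N ≤ T) :
    ∫⁻ ω, F (cumulative φ arm out (N + 1) ω) ∂μ +
        ∑ t ∈ Finset.Icc 1 N, ∫⁻ ω, G (arm t ω) (cumulative φ arm out t ω) ∂μ ≤
      F 0 + ∑ t ∈ Finset.Icc 1 N, ∫⁻ ω, H (arm t ω) (cumulative φ arm out t ω) ∂μ := by
  induction N with
  | zero => simp [cumulative_one]
  | succ n ih =>
    have hc := measurable_cumulative hφ hI.measurable_arm hI.measurable_out (n + 1)
    have hstep := lintegral_cumulative_succ_add_le hI
      (Finset.mem_Icc.mpr ⟨(by omega : 1 ≤ n + 1), hN⟩) hφ hF hG h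
    rw [lintegral_add_left (show Measurable fun ω => F (cumulative φ arm out (n + 1) ω) from
      hF.comp hc)] at hstep
    rw [Finset.sum_Icc_succ_top (by omega), Finset.sum_Icc_succ_top (by omega)]
    calc _ = (∫⁻ ω, F (cumulative φ arm out (n + 1 + 1) ω) ∂μ +
          ∫⁻ ω, G (arm (n + 1) ω) (cumulative φ arm out (n + 1) ω) ∂μ) +
          ∑ t ∈ Finset.Icc 1 n, ∫⁻ ω, G (arm t ω) (cumulative φ arm out t ω) ∂μ := by ring
      _ ≤ (∫⁻ ω, F (cumulative φ arm out (n + 1) ω) ∂μ +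
          ∫⁻ ω, H (arm (n + 1) ω) (cumulative φ arm out (n + 1) ω) ∂μ) +
          ∑ t ∈ Finset.Icc 1 n, ∫⁻ ω, G (arm t ω) (cumulative φ arm out t ω) ∂μ := by gcongr
      _ = (∫⁻ ω, F (cumulative φ arm out (n + 1) ω) ∂μ +
          ∑ t ∈ Finset.Icc 1 n, ∫⁻ ω, G (arm t ω) (cumulative φ arm out t ω) ∂μ) +
          ∫⁻ ω, H (arm (n + 1) ω) (cumulative φ arm out (n + 1) ω) ∂μ := by ring
      _ ≤ (F 0 + ∑ t ∈ Finset.Icc 1 n, ∫⁻ ω, H (arm t ω) (cumulative φ arm out t ω) ∂μ) +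
          ∫⁻ ω, H (arm (n + 1) ω) (cumulative φ arm out (n + 1) ω) ∂μ := by
        exact add_le_add_left (ih (by omega)) _
      _ = _ := by ring

end Telescope

/-! ### Pull counts, centred sums and their weighted second moments. -/

section Tally

variable {K m : ℕ}

/-- The contribution of one round to the number of pulls of the discretized arm `p_k = j / m` and
to the sum of its centred rewards. -/
def pairIncrement (env : Environment K) (k : Fin K) (j : ℕ) (a : GridArm K m) (o : Outcome K) :
    ℕ × ℝ :=
  if a.1 k = j then (1, reward (o k) - expectedReward env a k) else 0

theorem measurable_pairIncrement (env : Environment K) (k : Fin K) (j : ℕ) (a : GridArm K m) :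
    Measurable (pairIncrement env k j a) := by
  unfold pairIncrement
  split_ifs
  · exact measurable_const.prodMk
      ((measurable_reward.comp (measurable_pi_apply k)).sub measurable_const)
  · exact measurable_const

variable {Ω : Type*} (env : Environment K) (arm : ℕ → Ω → GridArm K m)
  (out : ℕ → Ω → Outcome K)

/-- The number of pulls of the discretized arm `p_k = j / m` before round `t`, and the sum of its
centred rewards. -/
def tally (k : Fin K) (j t : ℕ) (ω : Ω) : ℕ × ℝ :=
  cumulative (pairIncrement env k j) arm out t ω

theorem tally_fst (k : Fin K) (j t : ℕ) (ω : Ω) :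
    (tally env arm out k j t ω).1 = pulls arm t ω k j := by
  simp only [tally, cumulative, Prod.fst_sum, pulls, pullRounds, Finset.card_filter]
  refine Finset.sum_congr rfl fun s _ => ?_
  unfold pairIncrement
  split_ifs <;> rfl

theorem tally_snd (k : Fin K) (j t : ℕ) (ω : Ω) :
    (tally env arm out k j t ω).2 = ∑ s ∈ pullRounds arm t ω k j,
      (reward (out s ω k) - expectedReward env (arm s ω) k) := by
  simp only [tally, cumulative, Prod.snd_sum, pullRounds, Finset.sum_filter]
  refine Finset.sum_congr rfl fun s _ => ?_
  unfold pairIncrement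
  split_ifs <;> rfl

theorem pulls_succ (k : Fin K) (j : ℕ) {t : ℕ} (ht : 1 ≤ t) (ω : Ω) :
    pulls arm (t + 1) ω k j = pulls arm t ω k j + if (arm t ω).1 k = j then 1 else 0 := by
  simp only [pulls, pullRounds, Finset.card_filter, Finset.sum_Ico_succ_top ht]

theorem pulls_le (k : Fin K) (j t : ℕ) (ω : Ω) : pulls arm t ω k j ≤ t - 1 := by
  refine (Finset.card_filter_le _ _).trans ?_
  simp

theorem tally_snd_eq (k : Fin K) (a : GridArm K m) (t : ℕ) (ω : Ω) :
    (tally env arm out k (a.1 k) t ω).2 =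
      (a.prob k : ℝ) * (∑ s ∈ pullRounds arm t ω k (a.1 k), weightedReward (arm s ω) (out s ω) k) -
        pulls arm t ω k (a.1 k) * expectedReward env a k := by
  rw [tally_snd, Finset.mul_sum, pulls, ← nsmul_eq_mul, ← Finset.sum_const,
    ← Finset.sum_sub_distrib]
  refine Finset.sum_congr rfl fun s hs => ?_
  have hs' : (arm s ω).1 k = a.1 k := (Finset.mem_filter.mp hs).2
  rw [expectedReward_congr env hs', weightedReward, GridArm.prob_congr hs', reward]
  have := (a.prob_pos k).ne'
  congr 1
  split_ifs
  · field_simp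
  · simp

theorem prob_mul_empMean (k : Fin K) (a : GridArm K m) (t : ℕ) (ω : Ω)
    (h : 1 ≤ pulls arm t ω k (a.1 k)) :
    (a.prob k : ℝ) * empMean arm out t ω k (a.1 k) = expectedReward env a k +
      (tally env arm out k (a.1 k) t ω).2 / pulls arm t ω k (a.1 k) := by
  have hn : (0 : ℝ) < pulls arm t ω k (a.1 k) := by exact_mod_cast h
  rw [tally_snd_eq, empMean]
  field_simp
  ring

theorem neg_tally_snd_le (k : Fin K) (a : GridArm K m) (t : ℕ) (ω : Ω) :
    -(tally env arm out k (a.1 k) t ω).2 ≤ (a.prob k : ℝ) * pulls arm t ω k (a.1 k) := by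
  rw [tally_snd, pulls, ← Finset.sum_neg_distrib, mul_comm, ← nsmul_eq_mul, ← Finset.sum_const]
  refine Finset.sum_le_sum fun s hs => ?_
  have hs' : (arm s ω).1 k = a.1 k := (Finset.mem_filter.mp hs).2
  have h1 := expectedReward_le_prob env (arm s ω) k
  rw [GridArm.prob_congr hs'] at h1
  linarith [reward_nonneg (out s ω k)]

/-- Each pull raises the count by one, and `log (x+2) - log (x+1) ≥ 1 / (x+2)`. -/
theorem sum_inv_pulls_le (k : Fin K) (j N : ℕ) (ω : Ω) :
    ∑ t ∈ Finset.Icc 1 N, (if (arm t ω).1 k = j then 1 / ((pulls arm t ω k j : ℝ) + 2) else 0) ≤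
      Real.log (pulls arm (N + 1) ω k j + 1) := by
  induction N with
  | zero => simpa using Real.log_nonneg (by simp)
  | succ n ih =>
    rw [Finset.sum_Icc_succ_top (by omega), pulls_succ arm k j (by omega : 1 ≤ n + 1)]
    split_ifs with h
    · set x : ℝ := (pulls arm (n + 1) ω k j : ℝ)
      have hx : 0 ≤ x := Nat.cast_nonneg _
      have h1 := Real.add_one_le_exp (Real.log ((x + 1) / (x + 2)))
      rw [Real.exp_log (by positivity), Real.log_div (by positivity) (by positivity)] at h1
      have h2 : (x + 1) / (x + 2) = 1 - 1 / (x + 2) := by field_simp; ring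
      push_cast
      rw [show x + 1 + 1 = x + 2 by ring]
      linarith
    · simpa using ih

/-- The summands of the weighted second moment of the centred empirical means of the discretized
arm `p_k = j / m` over the rounds in which it is pulled. -/
def sqDeviation (k : Fin K) (j t : ℕ) (ω : Ω) : ℝ :=
  if (arm t ω).1 k = j then (tally env arm out k j t ω).2 ^ 2 /
    (((pulls arm t ω k j : ℝ) + 1) * ((pulls arm t ω k j : ℝ) + 2)) else 0

theorem sqDeviation_nonneg (k : Fin K) (j t : ℕ) (ω : Ω) :
    0 ≤ sqDeviation env arm out k j t ω := by
  unfold sqDeviation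
  split_ifs <;> positivity

variable [MeasurableSpace Ω] {env arm out} {T : ℕ} {μ : Measure Ω}

theorem measurable_tally (hI : IsInteraction env T μ arm out) (k : Fin K) (j t : ℕ) :
    Measurable (tally env arm out k j t) :=
  measurable_cumulative (measurable_pairIncrement env k j) hI.measurable_arm hI.measurable_out t

theorem measurable_pulls (hI : IsInteraction env T μ arm out) (k : Fin K) (j t : ℕ) :
    Measurable fun ω => pulls arm t ω k j := by
  simp_rw [← tally_fst env arm out]
  exact measurable_fst.comp (measurable_tally hI k j t)

theorem measurableSet_arm_apply_eq (hI : IsInteraction env T μ arm out) (k : Fin K) (j t : ℕ) :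
    MeasurableSet {ω | (arm t ω).1 k = j} :=
  hI.measurable_arm t (Set.to_countable {a : GridArm K m | a.1 k = j}).measurableSet

theorem measurable_sqDeviation (hI : IsInteraction env T μ arm out) (k : Fin K) (j t : ℕ) :
    Measurable (sqDeviation env arm out k j t) := by
  have h1 := measurable_snd.comp (measurable_tally hI k j t)
  have h2 : Measurable fun ω => (pulls arm t ω k j : ℝ) :=
    measurable_from_top.comp (measurable_pulls hI k j t)
  exact Measurable.ite (measurableSet_arm_apply_eq hI k j t)
    ((h1.pow_const 2).div ((h2.add_const 1).mul (h2.add_const 2))) measurable_const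

/-- A pull takes the potential `w² / (n+1)` to at most `(w² + 1) / (n+2)` in expectation: it drops
by the summand `w² / ((n+1)(n+2))` and gains at most `1 / (n+2)`. The gains add up to a logarithm.
-/
theorem sum_lintegral_sqDeviation_le [IsProbabilityMeasure μ]
    (hI : IsInteraction env T μ arm out) (k : Fin K) (j : ℕ) :
    ∑ t ∈ Finset.Icc 1 T, ∫⁻ ω, ENNReal.ofReal (sqDeviation env arm out k j t ω) ∂μ ≤
      ENNReal.ofReal (Real.log (T + 1)) := by
  have hcast : Measurable fun x : ℕ × ℝ => (x.1 : ℝ) := measurable_from_top.comp measurable_fst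
  have key := lintegral_cumulative_add_sum_le hI (measurable_pairIncrement env k j)
    (F := fun x => ENNReal.ofReal (x.2 ^ 2 / ((x.1 : ℝ) + 1)))
    (G := fun a x => ENNReal.ofReal
      (if a.1 k = j then x.2 ^ 2 / (((x.1 : ℝ) + 1) * ((x.1 : ℝ) + 2)) else 0))
    (H := fun a x => ENNReal.ofReal (if a.1 k = j then 1 / ((x.1 : ℝ) + 2) else 0))
    (ENNReal.measurable_ofReal.comp ((measurable_snd.pow_const 2).div (hcast.add_const 1)))
    (fun a => ENNReal.measurable_ofReal.comp (Measurable.ite (MeasurableSet.const _)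
      ((measurable_snd.pow_const 2).div ((hcast.add_const 1).mul (hcast.add_const 2)))
      measurable_const)) ?_ le_rfl
  · have e1 : ∀ t ω, (if (arm t ω).1 k = j then (cumulative (pairIncrement env k j) arm out t ω).2
        ^ 2 / ((((cumulative (pairIncrement env k j) arm out t ω).1 : ℝ) + 1) *
        (((cumulative (pairIncrement env k j) arm out t ω).1 : ℝ) + 2)) else 0) =
        sqDeviation env arm out k j t ω := fun t ω => by
      rw [sqDeviation, ← tally_fst env arm out]; rfl
    have e2 : ∀ t ω, (if (arm t ω).1 k = j then
        1 / (((cumulative (pairIncrement env k j) arm out t ω).1 : ℝ) + 2) else 0) =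
        if (arm t ω).1 k = j then 1 / ((pulls arm t ω k j : ℝ) + 2) else 0 := fun t ω => by
      rw [← tally_fst env arm out]; rfl
    simp only [e1, e2] at key
    refine (le_add_of_nonneg_left bot_le).trans (key.trans ?_)
    have hm : ∀ t, Measurable fun ω =>
        ENNReal.ofReal (if (arm t ω).1 k = j then 1 / ((pulls arm t ω k j : ℝ) + 2) else 0) :=
      fun t => ENNReal.measurable_ofReal.comp (Measurable.ite (measurableSet_arm_apply_eq hI k j t)
        (((measurable_from_top.comp (measurable_pulls hI k j t)).add_const 2).const_div 1)
        measurable_const)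
    rw [← lintegral_finsetSum _ fun t _ => hm t]
    simp only [Prod.snd_zero, ne_eq, OfNat.ofNat_ne_zero, not_false_eq_true, zero_pow, zero_div,
      ENNReal.ofReal_zero, zero_add]
    calc _ ≤ ∫⁻ _, ENNReal.ofReal (Real.log (T + 1)) ∂μ := by
          refine lintegral_mono fun ω => ?_
          simp only
          rw [← ENNReal.ofReal_sum_of_nonneg fun t _ => by split_ifs <;> positivity]
          refine ENNReal.ofReal_le_ofReal ((sum_inv_pulls_le arm k j T ω).trans ?_)
          refine Real.log_le_log (by positivity) ?_
          have : (pulls arm (T + 1) ω k j : ℝ) ≤ T := by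
            exact_mod_cast (pulls_le arm k j (T + 1) ω)
          linarith
      _ = _ := by simp
  · rintro a ⟨n, w⟩
    simp only [pairIncrement]
    split_ifs with h
    · simp only [Prod.mk_add_mk, Nat.cast_add, Nat.cast_one]
      have hn : (0 : ℝ) ≤ n := Nat.cast_nonneg n
      rw [← ofReal_integral_eq_lintegral_ofReal (integrable_of_reward (env.outcomeLaw a)
          (g := fun y => (w + (y - expectedReward env a k)) ^ 2 / ((n : ℝ) + 1 + 1))
          (by fun_prop) (measurable_pi_apply k)) (ae_of_all _ fun o => by positivity),
        ← ENNReal.ofReal_add (integral_nonneg fun o => by positivity) (by positivity),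
        ← ENNReal.ofReal_add (by positivity) (by positivity)]
      refine ENNReal.ofReal_le_ofReal ?_
      rw [integral_div]
      have h1 := integral_sq_add_le env a k w
      calc _ ≤ (w ^ 2 + 1) / ((n : ℝ) + 1 + 1) + w ^ 2 / (((n : ℝ) + 1) * (n + 2)) := by gcongr
        _ = _ := by field_simp; ring
    · simp

end Tally


/-! ### The comparison arm is rarely underestimated. -/

section Underestimation

theorem continuous_dyadicMixture (L : ℕ) (p : ℝ) (n : ℕ) : Continuous (dyadicMixture L p n) := by
  unfold dyadicMixture
  fun_prop

variable {K m : ℕ} {Ω : Type*} (env : Environment K)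

/-- The product over the base arms of the mixture supermartingales that control how much the
discretized arms in `b` are underestimated. -/
def mixtureProduct (b : GridArm K m) (L : ℕ) (x : Fin K → ℕ × ℝ) : ℝ :=
  ∏ k, dyadicMixture L (b.prob k) (x k).1 (-(x k).2)

theorem measurable_mixtureProduct (b : GridArm K m) (L : ℕ) :
    Measurable (mixtureProduct b L) :=
  Finset.measurable_fun_prod _ fun k _ =>
    (measurable_from_prod_countable_right
      (f := fun z : ℕ × ℝ => dyadicMixture L (b.prob k) z.1 (-z.2)) fun n =>
      (continuous_dyadicMixture L _ n).measurable.comp measurable_neg).comp (measurable_pi_apply k)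

/-- Base arms are independent within a round, so the expectation factorizes. Factors with `a_k ≠
b_k` do not move; the others do not increase in expectation. -/
theorem lintegral_mixtureProduct_add_le (a b : GridArm K m) (L : ℕ) (x : Fin K → ℕ × ℝ) :
    ∫⁻ o, ENNReal.ofReal (mixtureProduct b L (x + fun k => pairIncrement env k (b.1 k) a o))
      ∂(env.outcomeLaw a) ≤ ENNReal.ofReal (mixtureProduct b L x) := by
  set g : Fin K → ℝ → ℝ := fun k y => if a.1 k = b.1 k then
      dyadicMixture L (a.prob k) ((x k).1 + 1) (-(x k).2 + (expectedReward env a k - y))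
    else dyadicMixture L (b.prob k) (x k).1 (-(x k).2) with hg
  have hgc : ∀ k, Continuous (g k) := fun k => by
    simp only [hg]
    split_ifs
    · exact (continuous_dyadicMixture L _ _).comp (by fun_prop)
    · exact continuous_const
  have e : ∀ o : Outcome K, mixtureProduct b L (x + fun k => pairIncrement env k (b.1 k) a o) =
      ∏ k, g k (reward (o k)) := fun o => by
    refine Finset.prod_congr rfl fun k _ => ?_
    simp only [hg, Pi.add_apply, pairIncrement]
    split_ifs with h
    · rw [← GridArm.prob_congr h]
      simp only [Prod.fst_add, Prod.snd_add]
      congr 1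
      ring
    · simp
  have hg0 : ∀ k y, 0 ≤ g k y := fun k y => by
    simp only [hg]
    split_ifs <;> exact dyadicMixture_nonneg _ _ _ _
  have hint : Integrable (fun o : Outcome K => ∏ k, g k (reward (o k))) (env.outcomeLaw a) := by
    rw [outcomeLaw_eq]
    exact Integrable.fintype_prod (f := fun k z => g k (reward z)) fun k =>
      integrable_of_reward (armLaw env a k) (hgc k) measurable_id
  simp_rw [e]
  rw [← ofReal_integral_eq_lintegral_ofReal hint
    (ae_of_all _ fun o => Finset.prod_nonneg fun k _ => hg0 k _)]
  refine ENNReal.ofReal_le_ofReal ?_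
  rw [outcomeLaw_eq, integral_fintype_prod_eq_prod (fun k z => g k (reward z))]
  refine Finset.prod_le_prod (fun k _ => integral_nonneg fun z => hg0 k _) fun k _ => ?_
  simp only [hg]
  split_ifs with h
  · rw [← GridArm.prob_congr h]
    exact integral_dyadicMixture_le env a k L _ _
  · simp

/-- The event that the mixtures for the discretized arms in `b` are exceptionally large. -/
def underestimation (arm : ℕ → Ω → GridArm K m) (out : ℕ → Ω → Outcome K) (b : GridArm K m)
    (t : ℕ) : Set Ω :=
  {ω | Real.exp (3 / 8 * (K * Real.log t) - K) ≤
    mixtureProduct b (Nat.clog 4 t) fun k => tally env arm out k (b.1 k) t ω}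

/-- Off the exceptional event `Q ≤ K ln t`. Cauchy–Schwarz with weights `p_k / n_k`, which sum to at
most `1 / min n_k` because `∑ p_k = 1`, then gives exactly the bonus. -/
theorem utility_le_ucb (arm : ℕ → Ω → GridArm K m) (out : ℕ → Ω → Outcome K)
    (hK : 1 ≤ K) (b : GridArm K m) {t : ℕ} {ω : Ω} (ht : 2 ≤ t)
    (hn : ∀ k, 1 ≤ pulls arm t ω k (b.1 k)) (hω : ω ∉ underestimation env arm out b t) :
    env.utility b.prob ≤ ucb arm out t ω b := by
  have : Nonempty (Fin K) := ⟨⟨0, hK⟩⟩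
  set n : Fin K → ℝ := fun k => pulls arm t ω k (b.1 k) with hndef
  set w : Fin K → ℝ := fun k => (tally env arm out k (b.1 k) t ω).2 with hw
  set p : Fin K → ℝ := fun k => b.prob k with hp
  have hn0 : ∀ k, 0 < n k := fun k => Nat.cast_pos.mpr (hn k)
  have hp0 : ∀ k, 0 < p k := fun k => b.prob_pos k
  have hm : 0 < m := b.pos ⟨0, hK⟩
  have hp1 : ∑ k, p k = 1 := b.sum_prob hm
  set N : ℝ := ((⨅ k, pulls arm t ω k (b.1 k) : ℕ) : ℝ) with hN
  have hNn : ∀ k, N ≤ n k := fun k => by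
    simp only [hN, hndef]
    exact_mod_cast ciInf_le (OrderBot.bddBelow _) k
  have hN0 : 0 < N := by
    have : 1 ≤ ⨅ k, pulls arm t ω k (b.1 k) := le_ciInf hn
    exact Nat.cast_pos.mpr this
  have hQ : ∑ k, max (-w k) 0 ^ 2 / (p k * n k) ≤ K * Real.log t := by
    by_contra hcon
    push Not at hcon
    refine hω ?_
    have h1 : ∀ k, Real.exp (3 / 8 * (max (-w k) 0 ^ 2 / (p k * n k)) - 1) ≤
        dyadicMixture (Nat.clog 4 t) (b.prob k) (tally env arm out k (b.1 k) t ω).1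
          (-(tally env arm out k (b.1 k) t ω).2) := fun k => by
      rw [tally_fst]
      refine exp_le_dyadicMixture (hp0 k) (b.prob k).2.2 (hn k) ?_
        (neg_tally_snd_le env arm out k b t ω)
      exact ((pulls_le arm k (b.1 k) t ω).trans (Nat.sub_le _ _)).trans
        (Nat.le_pow_clog (by norm_num) t)
    have h2 := Finset.prod_le_prod (s := Finset.univ) (fun k _ => (Real.exp_pos _).le)
      fun k _ => h1 k
    rw [← Real.exp_sum, Finset.sum_sub_distrib, ← Finset.mul_sum] at h2
    refine le_trans (Real.exp_le_exp.mpr ?_) h2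
    simp only [Finset.sum_const, Finset.card_univ, Fintype.card_fin, nsmul_eq_mul, mul_one]
    linarith
  have hdev : ∑ k, -w k / n k ≤ √(K * Real.log t / N) := by
    -- Positive parts are taken because the mixtures control only downward deviations.
    refine Real.le_sqrt_of_sq_le ?_ |>.trans' (?_ : _ ≤ ∑ k, max (-w k) 0 / n k)
    · have hcs := Finset.sum_mul_sq_le_sq_mul_sq Finset.univ
        (fun k => max (-w k) 0 / √(p k * n k)) (fun k => √(p k / n k))
      have e1 : ∀ k, max (-w k) 0 / √(p k * n k) * √(p k / n k) = max (-w k) 0 / n k := fun k => by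
        rw [Real.sqrt_mul (hp0 k).le, Real.sqrt_div (hp0 k).le]
        have h1 := Real.sqrt_pos.mpr (hp0 k)
        have h2 := Real.sqrt_pos.mpr (hn0 k)
        have h3 := Real.mul_self_sqrt (hn0 k).le
        field_simp
        rw [sq, h3, mul_div_cancel_right₀ _ (hn0 k).ne']
      have e2 : ∀ k, (max (-w k) 0 / √(p k * n k)) ^ 2 = max (-w k) 0 ^ 2 / (p k * n k) :=
        fun k => by rw [div_pow, Real.sq_sqrt (mul_pos (hp0 k) (hn0 k)).le]
      have e3 : ∀ k, √(p k / n k) ^ 2 = p k / n k := fun k =>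
        Real.sq_sqrt (div_pos (hp0 k) (hn0 k)).le
      simp only [e1, e2, e3] at hcs
      refine hcs.trans ?_
      rw [div_eq_mul_one_div]
      have hlog : 0 ≤ Real.log t := Real.log_nonneg (by exact_mod_cast (by omega : 1 ≤ t))
      refine mul_le_mul hQ ?_ (Finset.sum_nonneg fun k _ => (div_pos (hp0 k) (hn0 k)).le)
        (by positivity)
      calc ∑ k, p k / n k ≤ ∑ k, p k / N :=
            Finset.sum_le_sum fun k _ => div_le_div_of_nonneg_left (hp0 k).le hN0 (hNn k)
        _ = 1 / N := by rw [← Finset.sum_div, hp1]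
    · exact Finset.sum_le_sum fun k _ =>
        div_le_div_of_nonneg_right (le_max_left _ _) (hn0 k).le
  have hsum : ∑ k, (b.prob k : ℝ) * empMean arm out t ω k (b.1 k) =
      env.utility b.prob - ∑ k, -w k / n k := by
    rw [Environment.utility, ← Finset.sum_sub_distrib]
    refine Finset.sum_congr rfl fun k _ => ?_
    rw [prob_mul_empMean env arm out k b t ω (hn k), expectedReward]
    simp only [hw, hndef]
    ring
  rw [ucb, hsum]
  linarith

variable {env} {arm : ℕ → Ω → GridArm K m} {out : ℕ → Ω → Outcome K}

theorem cumulative_pi_apply (b : GridArm K m) (t : ℕ) (ω : Ω) :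
    cumulative (fun a o k => pairIncrement env k (b.1 k) a o) arm out t ω =
      fun k => tally env arm out k (b.1 k) t ω := by
  ext1 k
  simp [cumulative, tally]

variable [MeasurableSpace Ω] {T : ℕ} {μ : Measure Ω}

theorem measurableSet_underestimation (hI : IsInteraction env T μ arm out) (b : GridArm K m)
    (t : ℕ) : MeasurableSet (underestimation env arm out b t) :=
  measurableSet_le measurable_const ((measurable_mixtureProduct b _).comp
    (measurable_pi_lambda _ fun k => measurable_tally hI k (b.1 k) t))

/-- Markov's inequality for the mixture product, whose initial value is `(L + 2)^K`: each factor
starts as `L + 2` ones. -/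
theorem measure_underestimation_le [IsProbabilityMeasure μ] (hI : IsInteraction env T μ arm out)
    (b : GridArm K m) {t : ℕ} (ht : t ∈ Finset.Icc 1 T) :
    μ.real (underestimation env arm out b t) ≤
      (((Nat.clog 4 t : ℝ) + 2) * (Real.exp 1 * (t : ℝ) ^ (-(3 / 8) : ℝ))) ^ K := by
  obtain ⟨ht1, htT⟩ := Finset.mem_Icc.mp ht
  have htpos : (0 : ℝ) < t := by exact_mod_cast ht1
  set L := Nat.clog 4 t
  have hφ : ∀ a : GridArm K m,
      Measurable fun (o : Outcome K) (k : Fin K) => pairIncrement env k (b.1 k) a o :=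
    fun a => measurable_pi_lambda _ fun k => measurable_pairIncrement env k (b.1 k) a
  have hM : Measurable fun x => ENNReal.ofReal (mixtureProduct b L x) :=
    ENNReal.measurable_ofReal.comp (measurable_mixtureProduct b L)
  have key := lintegral_cumulative_add_sum_le hI
    (φ := fun a o k => pairIncrement env k (b.1 k) a o) hφ hM
    (G := fun _ _ => 0) (H := fun _ _ => 0) (fun _ => measurable_const)
    (fun a x => by
      simpa only [add_zero] using lintegral_mixtureProduct_add_le env a b L x)
    (N := t - 1) (by omega)
  simp only [lintegral_zero, Finset.sum_const_zero, add_zero, Nat.sub_add_cancel ht1,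
    cumulative_pi_apply] at key
  have h0 : mixtureProduct b L 0 = ((L : ℝ) + 2) ^ K := by
    simp [mixtureProduct, dyadicMixture]
    ring
  rw [h0] at key
  have hmeas : Measurable fun ω => ENNReal.ofReal
      (mixtureProduct b L fun k => tally env arm out k (b.1 k) t ω) :=
    hM.comp (measurable_pi_lambda _ fun k => measurable_tally hI k (b.1 k) t)
  set c := Real.exp (3 / 8 * (K * Real.log t) - K) with hc
  have hmarkov := (mul_meas_ge_le_lintegral hmeas (ENNReal.ofReal c)).trans key
  have hsub : μ (underestimation env arm out b t) ≤ μ {ω | ENNReal.ofReal c ≤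
      ENNReal.ofReal (mixtureProduct b L fun k => tally env arm out k (b.1 k) t ω)} :=
    measure_mono fun ω hω => ENNReal.ofReal_le_ofReal hω
  have h1 : ENNReal.ofReal c * μ (underestimation env arm out b t) ≤
      ENNReal.ofReal (((L : ℝ) + 2) ^ K) := (mul_le_mul_right hsub _).trans hmarkov
  have h2 := ENNReal.toReal_mono ENNReal.ofReal_ne_top h1
  rw [ENNReal.toReal_mul, ENNReal.toReal_ofReal (Real.exp_pos _).le,
    ENNReal.toReal_ofReal (by positivity)] at h2
  have h3 : c⁻¹ = (Real.exp 1 * (t : ℝ) ^ (-(3 / 8) : ℝ)) ^ K := by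
    rw [hc, ← Real.exp_neg, Real.rpow_def_of_pos htpos, ← Real.exp_add, ← Real.exp_nat_mul]
    congr 1
    ring
  rw [mul_pow, ← h3, ← div_eq_mul_inv, le_div_iff₀ (Real.exp_pos _), mul_comm]
  exact h2

end Underestimation


/-! ### Summation of the regret over the rounds. -/

section Regret

variable {K m : ℕ} {Ω : Type*}

/-- The total potential over the `K m` discretized arms is capped at `4 / b` each, and every round
pays `2b` beyond its growth. -/
theorem sum_inv_sqrt_iInf_pulls_le (arm : ℕ → Ω → GridArm K m) (hK : 1 ≤ K) {b : ℝ} (hb : 0 < b)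
    {s T : ℕ} (hs : 1 ≤ s) (hsT : s ≤ T + 1) (ω : Ω)
    (hn : ∀ t ∈ Finset.Icc s T, ∀ k, 1 ≤ pulls arm t ω k ((arm t ω).1 k)) :
    ∑ t ∈ Finset.Icc s T, 1 / √((⨅ k, pulls arm t ω k ((arm t ω).1 k) : ℕ) : ℝ) ≤
      2 * b * T + 4 * K * m / b := by
  have : Nonempty (Fin K) := ⟨⟨0, hK⟩⟩
  set g : ℕ → ℝ := fun n => 4 * min √(n : ℝ) (1 / b) with hg
  have hg0 : ∀ n, 0 ≤ g n := fun n => by positivity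
  have hgb : ∀ n, g n ≤ 4 / b := fun n => by
    have := min_le_right √(n : ℝ) (1 / b)
    rw [div_eq_mul_one_div 4 b]
    simp only [hg]
    linarith
  have hgmono : Monotone g := fun x y hxy => by
    simp only [hg]
    have : √(x : ℝ) ≤ √(y : ℝ) := Real.sqrt_le_sqrt (by exact_mod_cast hxy)
    gcongr
  set Φ : ℕ → ℝ := fun t => ∑ k, ∑ j ∈ Finset.Icc 1 m, g (pulls arm t ω k j) with hΦ
  have hmono : ∀ t, 1 ≤ t → ∀ k j, g (pulls arm t ω k j) ≤ g (pulls arm (t + 1) ω k j) :=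
    fun t ht k j => hgmono (by rw [pulls_succ arm k j ht]; omega)
  have hround : ∀ t ∈ Finset.Icc s T,
      1 / √((⨅ k, pulls arm t ω k ((arm t ω).1 k) : ℕ) : ℝ) ≤ 2 * b + (Φ (t + 1) - Φ t) := by
    intro t ht
    have ht1 : 1 ≤ t := hs.trans (Finset.mem_Icc.mp ht).1
    -- The round is charged to one coordinate attaining the minimum; the other potentials can only
    -- grow.
    obtain ⟨k, hk⟩ := exists_eq_ciInf_of_finite (f := fun k => pulls arm t ω k ((arm t ω).1 k))
    rw [← hk]
    set j := (arm t ω).1 k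
    have hj : j ∈ Finset.Icc 1 m := Finset.mem_Icc.mpr ⟨(arm t ω).2.1 k, (arm t ω).le k⟩
    have h1 := inv_sqrt_le_potential hb (hn t ht k)
    have h2 : g (pulls arm (t + 1) ω k j) - g (pulls arm t ω k j) ≤ Φ (t + 1) - Φ t := by
      simp only [hΦ]
      rw [← Finset.sum_sub_distrib]
      simp_rw [← Finset.sum_sub_distrib]
      have h3 := Finset.single_le_sum (s := Finset.Icc 1 m)
        (f := fun j => g (pulls arm (t + 1) ω k j) - g (pulls arm t ω k j))
        (fun j _ => sub_nonneg.mpr (hmono t ht1 k j)) hj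
      exact h3.trans (Finset.single_le_sum (s := Finset.univ)
        (f := fun k => ∑ j ∈ Finset.Icc 1 m,
          (g (pulls arm (t + 1) ω k j) - g (pulls arm t ω k j)))
        (fun k _ => Finset.sum_nonneg fun j _ => sub_nonneg.mpr (hmono t ht1 k j))
        (Finset.mem_univ k))
    rw [pulls_succ arm k j ht1, if_pos rfl] at h2
    simp only [hg] at h2
    push_cast at h2
    linarith
  refine (Finset.sum_le_sum hround).trans ?_
  rw [Finset.sum_add_distrib]
  have htel : ∑ t ∈ Finset.Icc s T, (Φ (t + 1) - Φ t) = Φ (T + 1) - Φ s := by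
    rw [← Finset.Ico_add_one_right_eq_Icc]
    exact Finset.sum_Ico_sub Φ hsT
  rw [htel]
  have hΦ0 : 0 ≤ Φ s := Finset.sum_nonneg fun k _ => Finset.sum_nonneg fun j _ => hg0 _
  have hΦ1 : Φ (T + 1) ≤ 4 * K * m / b := by
    calc Φ (T + 1) ≤ ∑ _k : Fin K, ∑ _j ∈ Finset.Icc 1 m, 4 / b :=
          Finset.sum_le_sum fun k _ => Finset.sum_le_sum fun j _ => hgb _
      _ = 4 * K * m / b := by simp; ring
  have hcard : ∑ _t ∈ Finset.Icc s T, 2 * b ≤ 2 * b * T := by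
    rw [Finset.sum_const, nsmul_eq_mul, Nat.card_Icc, mul_comm]
    have : ((T + 1 - s : ℕ) : ℝ) ≤ T := by exact_mod_cast (by omega : T + 1 - s ≤ T)
    gcongr
  linarith

/-- `w/n ≤ c/2 + (w/n)²/(2c)`, together with `(n+1)(n+2) ≤ 6n²`. -/
theorem div_le_half_add_sq {c w : ℝ} (hc : 0 < c) {n : ℕ} (hn : 1 ≤ n) :
    w / n ≤ c / 2 + 3 / c * (w ^ 2 / (((n : ℝ) + 1) * ((n : ℝ) + 2))) := by
  have hn1 : (1 : ℝ) ≤ n := by exact_mod_cast hn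
  set x : ℝ := (n : ℝ)
  have hx : 0 < x := by linarith
  have h1 : w ^ 2 / x ^ 2 ≤ 6 * (w ^ 2 / ((x + 1) * (x + 2))) := by
    rw [← mul_div_assoc, div_le_div_iff₀ (by positivity) (by positivity)]
    have : (x + 1) * (x + 2) ≤ 6 * x ^ 2 := by nlinarith
    nlinarith [mul_le_mul_of_nonneg_left this (sq_nonneg w)]
  have h2 : w / x ≤ c / 2 + (w / x) ^ 2 / (2 * c) := by
    have : 0 ≤ (w / x - c) ^ 2 / (2 * c) := by positivity
    have e : (w / x - c) ^ 2 / (2 * c) = c / 2 + (w / x) ^ 2 / (2 * c) - w / x := by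
      field_simp; ring
    linarith
  rw [div_pow] at h2
  have h3 : w ^ 2 / x ^ 2 / (2 * c) ≤ 6 * (w ^ 2 / ((x + 1) * (x + 2))) / (2 * c) := by gcongr
  have e : 6 * (w ^ 2 / ((x + 1) * (x + 2))) / (2 * c) =
      3 / c * (w ^ 2 / ((x + 1) * (x + 2))) := by field_simp; ring
  linarith

variable (env : Environment K) (arm : ℕ → Ω → GridArm K m) (out : ℕ → Ω → Outcome K)

/-- The random part of the bound on the regret of round `t` against `b`. -/
def roundError (c : ℝ) (b : GridArm K m) (t : ℕ) (ω : Ω) : ℝ :=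
  3 / c * (∑ k, ∑ j ∈ Finset.Icc 1 m, sqDeviation env arm out k j t ω) +
    (underestimation env arm out b t).indicator (fun _ => 1) ω

theorem roundError_nonneg {c : ℝ} (hc : 0 < c) (b : GridArm K m) (t : ℕ) (ω : Ω) :
    0 ≤ roundError env arm out c b t ω := by
  refine add_nonneg (mul_nonneg (by positivity) (Finset.sum_nonneg fun k _ =>
    Finset.sum_nonneg fun j _ => sqDeviation_nonneg env arm out k j t ω)) ?_
  exact Set.indicator_nonneg (fun _ _ => zero_le_one) ω

theorem utility_sub_utility_le (hK : 1 ≤ K) {c : ℝ} (hc : 0 < c) (b : GridArm K m) {t T : ℕ}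
    (ht : 2 ≤ t) (htT : t ≤ T) {ω : Ω}
    (hn : ∀ (a : GridArm K m) k, 1 ≤ pulls arm t ω k (a.1 k))
    (hsel : ucb arm out t ω b ≤ ucb arm out t ω (arm t ω)) :
    env.utility b.prob - env.utility (arm t ω).prob ≤
      √(K * Real.log T) * (1 / √((⨅ k, pulls arm t ω k ((arm t ω).1 k) : ℕ) : ℝ)) +
        K * c / 2 + roundError env arm out c b t ω := by
  set a := arm t ω with ha
  have hm : 0 < m := b.pos ⟨0, hK⟩
  have hsq : ∑ k, (tally env arm out k (a.1 k) t ω).2 / pulls arm t ω k (a.1 k) ≤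
      K * c / 2 + 3 / c * (∑ k, ∑ j ∈ Finset.Icc 1 m, sqDeviation env arm out k j t ω) := by
    rw [Finset.mul_sum]
    have e : K * c / 2 = ∑ _k : Fin K, c / 2 := by simp; ring
    rw [e, ← Finset.sum_add_distrib]
    refine Finset.sum_le_sum fun k _ => (div_le_half_add_sq hc (hn a k)).trans ?_
    have h1 : (tally env arm out k (a.1 k) t ω).2 ^ 2 / (((pulls arm t ω k (a.1 k) : ℝ) + 1) *
        ((pulls arm t ω k (a.1 k) : ℝ) + 2)) = sqDeviation env arm out k (a.1 k) t ω := by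
      rw [sqDeviation, if_pos rfl]
    rw [h1]
    have h2 := Finset.single_le_sum (s := Finset.Icc 1 m)
      (f := fun j => sqDeviation env arm out k j t ω)
      (fun j _ => sqDeviation_nonneg env arm out k j t ω)
      (Finset.mem_Icc.mpr ⟨a.2.1 k, a.le k⟩)
    have h3 := mul_le_mul_of_nonneg_left h2 (by positivity : 0 ≤ 3 / c)
    linarith
  have hrad : √(K * Real.log t / ((⨅ k, pulls arm t ω k (a.1 k) : ℕ) : ℝ)) ≤
      √(K * Real.log T) * (1 / √((⨅ k, pulls arm t ω k (a.1 k) : ℕ) : ℝ)) := by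
    have htpos : (0 : ℝ) < t := by exact_mod_cast (by omega : 0 < t)
    have hlog : 0 ≤ Real.log t := Real.log_nonneg (by exact_mod_cast (by omega : 1 ≤ t))
    have hlog' : Real.log t ≤ Real.log T := Real.log_le_log htpos (by exact_mod_cast htT)
    rw [Real.sqrt_div (by positivity), div_eq_mul_one_div]
    gcongr
  -- On the exceptional event the indicator in `roundError` pays for the trivial bound `1`;
  -- otherwise optimism applies.
  by_cases hω : ω ∈ underestimation env arm out b t
  · have h1 := env.utility_le_one b.prob (b.sum_prob hm)
    have h2 := env.utility_nonneg a.prob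
    have h3 : 0 ≤ ∑ k, ∑ j ∈ Finset.Icc 1 m, sqDeviation env arm out k j t ω :=
      Finset.sum_nonneg fun k _ => Finset.sum_nonneg fun j _ =>
        sqDeviation_nonneg env arm out k j t ω
    rw [roundError, Set.indicator_of_mem hω]
    have h4 : 0 ≤ √(K * Real.log T) * (1 / √((⨅ k, pulls arm t ω k (a.1 k) : ℕ) : ℝ)) := by
      positivity
    have h5 : 0 ≤ 3 / c * (∑ k, ∑ j ∈ Finset.Icc 1 m, sqDeviation env arm out k j t ω) := by
      positivity
    have h6 : 0 ≤ (K : ℝ) * c / 2 := by positivity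
    linarith
  · have h1 := utility_le_ucb env arm out hK b ht (hn b) hω
    have h2 : ucb arm out t ω a =
        √(K * Real.log t / ((⨅ k, pulls arm t ω k (a.1 k) : ℕ) : ℝ)) + (env.utility a.prob +
          ∑ k, (tally env arm out k (a.1 k) t ω).2 / pulls arm t ω k (a.1 k)) := by
      rw [ucb, Environment.utility, ← Finset.sum_add_distrib]
      congr 1
      exact Finset.sum_congr rfl fun k _ => prob_mul_empMean env arm out k a t ω (hn a k)
    rw [roundError, Set.indicator_of_notMem hω]
    linarith

theorem one_le_pulls_of_exists {s t : ℕ} (hst : s < t) {k : Fin K} {j : ℕ} {ω : Ω}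
    (h : ∃ r ∈ Finset.Icc 1 s, (arm r ω).1 k = j) : 1 ≤ pulls arm t ω k j := by
  obtain ⟨r, hr, hrj⟩ := h
  rw [Finset.mem_Icc] at hr
  exact Finset.card_pos.mpr ⟨r, Finset.mem_filter.mpr ⟨Finset.mem_Ico.mpr ⟨hr.1, by omega⟩, hrj⟩⟩

theorem sum_utility_sub_le (hK : 1 ≤ K) {c d : ℝ} (hc : 0 < c) (hd : 0 < d) (b : GridArm K m)
    {T : ℕ} {ω : Ω}
    (hinit : K * m ≤ T → ∀ (a : GridArm K m) (k : Fin K),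
      ∃ s ∈ Finset.Icc 1 (K * m), (arm s ω).1 k = a.1 k)
    (hsel : ∀ t ∈ Finset.Icc (K * m + 1) T, ∀ a : GridArm K m,
      ucb arm out t ω a ≤ ucb arm out t ω (arm t ω)) :
    ∑ t ∈ Finset.Icc 1 T, (env.utility b.prob - env.utility (arm t ω).prob) ≤
      K * m + √(K * Real.log T) * (2 * d * T + 4 * K * m / d) + K * c / 2 * T +
        ∑ t ∈ Finset.Icc 1 T, roundError env arm out c b t ω := by
  have hm : 0 < m := b.pos ⟨0, hK⟩
  have hKm : 1 ≤ K * m := Nat.mul_pos hK hm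
  have hone : ∀ t, env.utility b.prob - env.utility (arm t ω).prob ≤ 1 := fun t => by
    linarith [env.utility_le_one b.prob (b.sum_prob hm), env.utility_nonneg (arm t ω).prob]
  have hE : ∀ s : Finset ℕ, 0 ≤ ∑ t ∈ s, roundError env arm out c b t ω := fun s =>
    Finset.sum_nonneg fun t _ => roundError_nonneg env arm out hc b t ω
  have hA : 0 ≤ √(K * Real.log T) * (2 * d * T + 4 * K * m / d) := by positivity
  have hB : 0 ≤ K * c / 2 * T := by positivity
  -- If the horizon ends during the initialization, the term `K * m` alone covers the regret.
  rcases lt_or_ge T (K * m) with hT | hT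
  · have h1 : ∑ t ∈ Finset.Icc 1 T, (env.utility b.prob - env.utility (arm t ω).prob) ≤ T := by
      refine (Finset.sum_le_sum fun t _ => hone t).trans ?_
      simp
    have h2 : (T : ℝ) ≤ K * m := by exact_mod_cast hT.le
    linarith [hE (Finset.Icc 1 T)]
  · have hn : ∀ t ∈ Finset.Icc (K * m + 1) T, ∀ (a : GridArm K m) k,
        1 ≤ pulls arm t ω k (a.1 k) := fun t ht a k =>
      one_le_pulls_of_exists arm (Nat.lt_of_succ_le (Finset.mem_Icc.mp ht).1) (hinit hT a k)
    have hsplit : ∀ f : ℕ → ℝ, ∑ t ∈ Finset.Icc 1 T, f t =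
        ∑ t ∈ Finset.Icc 1 (K * m), f t + ∑ t ∈ Finset.Icc (K * m + 1) T, f t := fun f => by
      simp only [← Finset.Ico_add_one_right_eq_Icc]
      exact (Finset.sum_Ico_consecutive f (by omega) (by omega)).symm
    have h1 : ∑ t ∈ Finset.Icc 1 (K * m), (env.utility b.prob - env.utility (arm t ω).prob) ≤
        K * m := by
      refine (Finset.sum_le_sum fun t _ => hone t).trans ?_
      simp
    have h2 : ∑ t ∈ Finset.Icc (K * m + 1) T,
        (env.utility b.prob - env.utility (arm t ω).prob) ≤
        √(K * Real.log T) * (2 * d * T + 4 * K * m / d) + K * c / 2 * T +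
          ∑ t ∈ Finset.Icc (K * m + 1) T, roundError env arm out c b t ω := by
      refine (Finset.sum_le_sum fun t ht => utility_sub_utility_le env arm out hK hc b
        (by have := (Finset.mem_Icc.mp ht).1; omega) (Finset.mem_Icc.mp ht).2
        (hn t ht) (hsel t ht b)).trans ?_
      rw [Finset.sum_add_distrib, Finset.sum_add_distrib, ← Finset.mul_sum]
      have h3 := sum_inv_sqrt_iInf_pulls_le arm hK hd (by omega : 1 ≤ K * m + 1)
        (by omega : K * m + 1 ≤ T + 1) ω fun t ht k => hn t ht (arm t ω) k
      have h4 : ∑ _t ∈ Finset.Icc (K * m + 1) T, K * c / 2 ≤ K * c / 2 * T := by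
        rw [Finset.sum_const, nsmul_eq_mul, Nat.card_Icc, mul_comm]
        have : ((T + 1 - (K * m + 1) : ℕ) : ℝ) ≤ T := by
          exact_mod_cast (by omega : T + 1 - (K * m + 1) ≤ T)
        gcongr
      gcongr
    rw [hsplit, hsplit fun t => roundError env arm out c b t ω]
    linarith [hE (Finset.Icc 1 (K * m))]

variable {env arm out} [MeasurableSpace Ω] {T : ℕ} {μ : Measure Ω}

theorem integrable_utility [IsFiniteMeasure μ] (hI : IsInteraction env T μ arm out) (hK : 1 ≤ K)
    (t : ℕ) : Integrable (fun ω => env.utility (arm t ω).prob) μ := by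
  have hmeas : Measurable fun a : GridArm K m => env.utility a.prob := measurable_of_countable _
  refine Integrable.of_bound (C := 1)
    (hmeas.comp (hI.measurable_arm t)).aestronglyMeasurable (ae_of_all _ fun ω => ?_)
  rw [Real.norm_of_nonneg (env.utility_nonneg _)]
  exact env.utility_le_one _ ((arm t ω).sum_prob ((arm t ω).pos ⟨0, hK⟩))

theorem integrable_sqDeviation [IsProbabilityMeasure μ] (hI : IsInteraction env T μ arm out)
    (k : Fin K) (j : ℕ) {t : ℕ} (ht : t ∈ Finset.Icc 1 T) :
    Integrable (sqDeviation env arm out k j t) μ := by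
  refine ⟨(measurable_sqDeviation hI k j t).aestronglyMeasurable, ?_⟩
  rw [hasFiniteIntegral_iff_ofReal (ae_of_all _ fun ω => sqDeviation_nonneg env arm out k j t ω)]
  exact (((Finset.single_le_sum
    (f := fun t => ∫⁻ ω, ENNReal.ofReal (sqDeviation env arm out k j t ω) ∂μ)
    (fun _ _ => bot_le) ht).trans
    (sum_lintegral_sqDeviation_le hI k j)).trans_lt ENNReal.ofReal_lt_top)

theorem sum_integral_sqDeviation_le [IsProbabilityMeasure μ]
    (hI : IsInteraction env T μ arm out) (k : Fin K) (j : ℕ) :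
    ∑ t ∈ Finset.Icc 1 T, ∫ ω, sqDeviation env arm out k j t ω ∂μ ≤ Real.log (T + 1) := by
  have h := sum_lintegral_sqDeviation_le hI k j
  have e : ∀ t ∈ Finset.Icc 1 T, ∫⁻ ω, ENNReal.ofReal (sqDeviation env arm out k j t ω) ∂μ =
      ENNReal.ofReal (∫ ω, sqDeviation env arm out k j t ω ∂μ) := fun t ht =>
    (ofReal_integral_eq_lintegral_ofReal (integrable_sqDeviation hI k j ht)
      (ae_of_all _ fun ω => sqDeviation_nonneg env arm out k j t ω)).symm
  rw [Finset.sum_congr rfl e, ← ENNReal.ofReal_sum_of_nonneg fun t _ =>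
    integral_nonneg fun ω => sqDeviation_nonneg env arm out k j t ω] at h
  exact (ENNReal.ofReal_le_ofReal_iff
    (Real.log_nonneg (by linarith [(Nat.cast_nonneg T : (0 : ℝ) ≤ T)]))).mp h

theorem integrable_roundError [IsProbabilityMeasure μ] (hI : IsInteraction env T μ arm out)
    (c : ℝ) (b : GridArm K m) {t : ℕ} (ht : t ∈ Finset.Icc 1 T) :
    Integrable (roundError env arm out c b t) μ :=
  ((integrable_finsetSum _ fun k _ => integrable_finsetSum _ fun j _ =>
    integrable_sqDeviation hI k j ht).const_mul _).add
    ((integrable_const 1).indicator (measurableSet_underestimation hI b t))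

theorem sum_integral_roundError_le [IsProbabilityMeasure μ] (hI : IsInteraction env T μ arm out)
    (hK : 1 ≤ K) {c : ℝ} (hc : 0 < c) (b : GridArm K m) {t₀ : ℕ}
    (ht₀ : ∀ t : ℕ, t₀ ≤ t → 1 ≤ t ∧
      ((Nat.clog 4 t : ℝ) + 2) * (Real.exp 1 * (t : ℝ) ^ (-(3 / 8) : ℝ)) ≤
        (t : ℝ) ^ (-(1 / 3) : ℝ)) :
    ∑ t ∈ Finset.Icc 1 T, ∫ ω, roundError env arm out c b t ω ∂μ ≤
      3 / c * (K * m * Real.log (T + 1)) + (t₀ + 2 * (T : ℝ) ^ (2 / 3 : ℝ)) := by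
  have e : ∀ t ∈ Finset.Icc 1 T, ∫ ω, roundError env arm out c b t ω ∂μ =
      3 / c * (∑ k, ∑ j ∈ Finset.Icc 1 m, ∫ ω, sqDeviation env arm out k j t ω ∂μ) +
        μ.real (underestimation env arm out b t) := fun t ht => by
    have h1 : ∀ k : Fin K, Integrable
        (fun ω => ∑ j ∈ Finset.Icc 1 m, sqDeviation env arm out k j t ω) μ := fun k =>
      integrable_finsetSum _ fun j _ => integrable_sqDeviation hI k j ht
    have h2 := integrable_finsetSum Finset.univ fun k _ => h1 k
    simp only [roundError]
    rw [integral_add (h2.const_mul _)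
      ((integrable_const (1 : ℝ)).indicator (measurableSet_underestimation hI b t)),
      integral_const_mul, integral_finsetSum _ fun k _ => h1 k,
      integral_indicator_const _ (measurableSet_underestimation hI b t)]
    simp only [smul_eq_mul, mul_one]
    congr 2
    exact Finset.sum_congr rfl fun k _ =>
      integral_finsetSum _ fun j _ => integrable_sqDeviation hI k j ht
  rw [Finset.sum_congr rfl e, Finset.sum_add_distrib, ← Finset.mul_sum]
  refine add_le_add (mul_le_mul_of_nonneg_left ?_ (by positivity)) ?_
  · rw [Finset.sum_comm]
    calc _ = ∑ k, ∑ j ∈ Finset.Icc 1 m, ∑ t ∈ Finset.Icc 1 T,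
          ∫ ω, sqDeviation env arm out k j t ω ∂μ :=
          Finset.sum_congr rfl fun k _ => Finset.sum_comm
      _ ≤ ∑ _k : Fin K, ∑ _j ∈ Finset.Icc 1 m, Real.log (T + 1) :=
          Finset.sum_le_sum fun k _ => Finset.sum_le_sum fun j _ =>
            sum_integral_sqDeviation_le hI k j
      _ = _ := by simp; ring
  · have h1 : ∀ t ∈ Finset.Icc 1 T, μ.real (underestimation env arm out b t) ≤
        (if t < t₀ then 1 else 0) + (t : ℝ) ^ (-(1 / 3) : ℝ) := fun t ht => by
      have hpos : 0 ≤ (t : ℝ) ^ (-(1 / 3) : ℝ) := by positivity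
      split_ifs with h
      · linarith [measureReal_le_one (μ := μ) (s := underestimation env arm out b t)]
      · obtain ⟨ht1, hle⟩ := ht₀ t (not_lt.mp h)
        have h3 : (t : ℝ) ^ (-(1 / 3) : ℝ) ≤ 1 :=
          Real.rpow_le_one_of_one_le_of_nonpos (by exact_mod_cast ht1) (by norm_num)
        rw [zero_add]
        -- The base of the `K`-th power is at most `1`, so the power can be dropped as `K ≥ 1`.
        exact (measure_underestimation_le hI b ht).trans
          ((pow_le_of_le_one (by positivity) (hle.trans h3) (by omega)).trans hle)
    refine (Finset.sum_le_sum h1).trans ?_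
    rw [Finset.sum_add_distrib]
    refine add_le_add ?_ (sum_rpow_neg_third_le T)
    rw [← Finset.sum_filter, Finset.sum_const, nsmul_eq_mul, mul_one]
    have : ({t ∈ Finset.Icc 1 T | t < t₀}).card ≤ t₀ := by
      refine (Finset.card_le_card (t := Finset.range t₀) fun t ht => ?_).trans
        (Finset.card_range t₀).le
      exact Finset.mem_range.mpr (Finset.mem_filter.mp ht).2
    exact_mod_cast this

theorem regret_le [IsProbabilityMeasure μ] (hU : IsActionDependentUCB env T μ arm out)
    (hK : 1 ≤ K) (hKm : K ≤ m) {c d : ℝ} (hc : 0 < c) (hd : 0 < d) {t₀ : ℕ}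
    (ht₀ : ∀ t : ℕ, t₀ ≤ t → 1 ≤ t ∧
      ((Nat.clog 4 t : ℝ) + 2) * (Real.exp 1 * (t : ℝ) ^ (-(3 / 8) : ℝ)) ≤
        (t : ℝ) ^ (-(1 / 3) : ℝ)) :
    regret env T μ arm ≤ 6 * K * T * (1 / m) + K * m +
      √(K * Real.log T) * (2 * d * T + 4 * K * m / d) + K * c / 2 * T +
        3 / c * (K * m * Real.log (T + 1)) + (t₀ + 2 * (T : ℝ) ^ (2 / 3 : ℝ)) := by
  classical
  have hI := hU.toIsInteraction
  have : Nonempty (Simplex K) := by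
    refine ⟨⟨fun k => if k = ⟨0, hK⟩ then 1 else 0, ?_⟩⟩
    rw [Finset.sum_eq_single (⟨0, hK⟩ : Fin K)] <;> simp +contextual
  rw [regret, sub_le_iff_le_add]
  refine ciSup_le fun p => ?_
  obtain ⟨b, hb⟩ := exists_gridArm_near hK hKm p
  have hpb : env.utility p.1 ≤ env.utility b.prob + 6 * K * (1 / m) := by
    have h1 := env.utility_sub_le p.1 b.prob
    have e : 6 * (K : ℝ) * (1 / m) = 2 * (3 * K / m) := by ring
    linarith
  have hint1 : Integrable (fun ω => ∑ t ∈ Finset.Icc 1 T, env.utility (arm t ω).prob) μ :=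
    integrable_finsetSum _ fun t _ => integrable_utility hI hK t
  have hint2 : Integrable
      (fun ω => ∑ t ∈ Finset.Icc 1 T, roundError env arm out c b t ω) μ :=
    integrable_finsetSum _ fun t ht => integrable_roundError hI c b ht
  set A : ℝ := K * m + √(K * Real.log T) * (2 * d * T + 4 * K * m / d) + K * c / 2 * T with hA
  have hpath : ∀ᵐ ω ∂μ, T * env.utility b.prob - A ≤
      ∑ t ∈ Finset.Icc 1 T, env.utility (arm t ω).prob +
        ∑ t ∈ Finset.Icc 1 T, roundError env arm out c b t ω := by
    have hinit : ∀ᵐ ω ∂μ, K * m ≤ T → ∀ (a : GridArm K m) (k : Fin K),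
        ∃ s ∈ Finset.Icc 1 (K * m), (arm s ω).1 k = a.1 k := by
      by_cases h : K * m ≤ T
      · filter_upwards [hU.initialization h] with ω hω _ using hω
      · exact ae_of_all _ fun ω h' => absurd h' h
    filter_upwards [hinit, hU.selection] with ω h1 h2
    have h3 := sum_utility_sub_le env arm out hK hc hd b h1 h2
    rw [Finset.sum_sub_distrib] at h3
    simp only [Finset.sum_const, Nat.card_Icc, Nat.add_sub_cancel, nsmul_eq_mul] at h3
    linarith
  have h4 := integral_mono_ae (integrable_const _) (hint1.add hint2) hpath
  simp only [Pi.add_apply] at h4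
  rw [integral_add hint1 hint2, integral_const, probReal_univ, one_smul,
    integral_finsetSum _ fun t ht => integrable_roundError hI c b ht] at h4
  have h5 := sum_integral_roundError_le hI hK hc b ht₀
  have h6 : ∑ _t ∈ Finset.Icc 1 T, env.utility p.1 = T * env.utility p.1 := by simp
  have h7 : (T : ℝ) * env.utility p.1 ≤ T * (env.utility b.prob + 6 * K * (1 / m)) :=
    mul_le_mul_of_nonneg_left hpb (Nat.cast_nonneg _)
  rw [h6]
  linarith

end Regret


/-! ### Choice of parameters and the final rate. -/

/-- The terms of the regret bound for the mesh and the tuning parameters of order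
`x = (ln T / T)^(1/3)`, in terms of `x` and `ℓ = ln T`. -/
theorem regret_terms_le {K m T x ℓ c₁ c₂ s S : ℝ} (hK : 1 ≤ K) (hm : 0 < m) (hT : 2 ≤ T)
    (hx : 0 < x) (hx1 : x ≤ 1) (hℓ : 1 / 2 ≤ ℓ) (hxℓ : T * x ^ 3 = ℓ) (hc₁ : 0 < c₁)
    (h₁ : c₁ * x ≤ 1 / m) (h₂ : 1 / m ≤ c₂ * x) (hs : 0 ≤ s) (hS1 : 1 ≤ S) (hS : S ≤ 2 * (T * x))
    {ℓ' : ℝ} (hℓ' : ℓ' ≤ 2 * ℓ) :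
    6 * K * T * (1 / m) + K * m +
      √(K * ℓ) * (2 * (√(K / ℓ) * x) * T + 4 * K * m / (√(K / ℓ) * x)) + K * x / 2 * T +
        3 / x * (K * m * ℓ') + (s + 2 * S) ≤
      (6 * c₂ + 12 / c₁ + 2 * s + 7) * (K * (T * x)) := by
  have hK0 : 0 < K := by linarith
  have hℓ0 : 0 < ℓ := by linarith
  have hT0 : 0 < T := by linarith
  have hTx : 0 < T * x := by positivity
  have hm_le : m ≤ 1 / (c₁ * x) := by
    rw [le_div_iff₀ (by positivity)]
    rw [le_div_iff₀ hm] at h₁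
    linarith
  have hinv : m ≤ 2 / c₁ * (T * x) := by
    refine hm_le.trans ?_
    rw [div_le_iff₀ (by positivity)]
    have e : 2 / c₁ * (T * x) * (c₁ * x) = 2 * (T * x ^ 2) := by field_simp
    have : T * x ^ 3 ≤ T * x ^ 2 := by
      refine mul_le_mul_of_nonneg_left ?_ hT0.le
      exact pow_le_pow_of_le_one hx.le hx1 (by norm_num)
    rw [e]
    linarith
  have hmℓ : m * ℓ / x ≤ 1 / c₁ * (T * x) := by
    rw [div_le_iff₀ hx, ← hxℓ]
    calc m * (T * x ^ 3) ≤ 1 / (c₁ * x) * (T * x ^ 3) := by gcongr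
      _ = _ := by field_simp
  have t1 : 6 * K * T * (1 / m) ≤ 6 * c₂ * (K * (T * x)) := by
    calc 6 * K * T * (1 / m) ≤ 6 * K * T * (c₂ * x) := by gcongr
      _ = _ := by ring
  have t2 : K * m ≤ 2 / c₁ * (K * (T * x)) := by
    calc K * m ≤ K * (2 / c₁ * (T * x)) := by gcongr
      _ = _ := by ring
  -- The cap parameter `√(K/ℓ) * x` balances the two bonus terms: the product with `√(K ℓ)` is `K`
  -- and the quotient is `ℓ`, so both are of order `K T x`.
  have hp : √(K * ℓ) * √(K / ℓ) = K := by
    rw [← Real.sqrt_mul (by positivity), show K * ℓ * (K / ℓ) = K ^ 2 by field_simp,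
      Real.sqrt_sq hK0.le]
  have hq : √(K * ℓ) / √(K / ℓ) = ℓ := by
    rw [← Real.sqrt_div (by positivity), show K * ℓ / (K / ℓ) = ℓ ^ 2 by field_simp,
      Real.sqrt_sq hℓ0.le]
  have t3 : √(K * ℓ) * (2 * (√(K / ℓ) * x) * T + 4 * K * m / (√(K / ℓ) * x)) ≤
      (2 + 4 / c₁) * (K * (T * x)) := by
    have e : √(K * ℓ) * (2 * (√(K / ℓ) * x) * T + 4 * K * m / (√(K / ℓ) * x)) =
        2 * (√(K * ℓ) * √(K / ℓ)) * (T * x) +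
          4 * K * (m * (√(K * ℓ) / √(K / ℓ)) / x) := by
      have : 0 < √(K / ℓ) := Real.sqrt_pos.mpr (by positivity)
      field_simp
    rw [e, hp, hq]
    calc _ ≤ 2 * K * (T * x) + 4 * K * (1 / c₁ * (T * x)) := by gcongr
      _ = _ := by ring
  have t4 : 3 / x * (K * m * ℓ') ≤ 6 / c₁ * (K * (T * x)) := by
    calc 3 / x * (K * m * ℓ') ≤ 3 / x * (K * m * (2 * ℓ)) := by gcongr
      _ = 6 * K * (m * ℓ / x) := by ring
      _ ≤ 6 * K * (1 / c₁ * (T * x)) := by gcongr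
      _ = _ := by ring
  have hKTx : T * x ≤ K * (T * x) := le_mul_of_one_le_left hTx.le hK
  have t5 : s + 2 * S ≤ (2 * s + 4) * (K * (T * x)) := by
    calc s + 2 * S ≤ s * S + 2 * S := by nlinarith
      _ = (s + 2) * S := by ring
      _ ≤ (s + 2) * (2 * (K * (T * x))) := by gcongr; linarith
      _ = _ := by ring
  have t6 : K * x / 2 * T = 1 / 2 * (K * (T * x)) := by ring
  have e : (6 * c₂ + 12 / c₁ + 2 * s + 7) * (K * (T * x)) = 6 * c₂ * (K * (T * x)) +
      2 / c₁ * (K * (T * x)) + (2 + 4 / c₁) * (K * (T * x)) + 1 / 2 * (K * (T * x)) +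
      6 / c₁ * (K * (T * x)) + (2 * s + 4) * (K * (T * x)) + 1 / 2 * (K * (T * x)) := by ring
  have : 0 < K * (T * x) := by positivity
  rw [e, t6]
  linarith

end ActionBandit

end

/-- Regret bound of Action-Dependent UCB with mesh `ε = 1 / m = Θ((ln T / T)^(1/3))`; the constant
`C` depends only on the constants `c₁, c₂` of the `Θ`. The condition `K ≤ m` says that the
discretized simplex is nonempty. -/
theorem theorem1 (c₁ c₂ : ℝ) (hc₁ : 0 < c₁) (hc₂ : c₁ ≤ c₂) :
    ∃ C : ℝ, 0 < C ∧
      ∀ (K m T : ℕ), 1 ≤ K → K ≤ m → 2 ≤ T →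
        c₁ * (Real.log T / T) ^ (1 / 3 : ℝ) ≤ 1 / (m : ℝ) →
        1 / (m : ℝ) ≤ c₂ * (Real.log T / T) ^ (1 / 3 : ℝ) →
        ∀ (env : ActionBandit.Environment K)
          (Ω : Type*) [MeasurableSpace Ω] (μ : MeasureTheory.Measure Ω)
          [MeasureTheory.IsProbabilityMeasure μ]
          (arm : ℕ → Ω → ActionBandit.GridArm K m) (out : ℕ → Ω → ActionBandit.Outcome K),
          ActionBandit.IsActionDependentUCB env T μ arm out →
          ActionBandit.regret env T μ arm ≤
            C * (K * (T : ℝ) ^ (2 / 3 : ℝ) * Real.log T ^ (1 / 3 : ℝ)) := by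
  obtain ⟨t₀, ht₀⟩ := ActionBandit.exists_clog_mul_rpow_le
  have hc₂' : 0 < c₂ := hc₁.trans_le hc₂
  refine ⟨6 * c₂ + 12 / c₁ + 2 * t₀ + 7, by positivity, ?_⟩
  intro K m T hK hKm hT h₁ h₂ env Ω _ μ _ arm out hU
  have hT2 : (2 : ℝ) ≤ T := by exact_mod_cast hT
  have hT0 : (0 : ℝ) < T := by linarith
  have hℓ : 1 / 2 ≤ Real.log T := by
    have := Real.log_le_log (by norm_num) hT2
    linarith [Real.log_two_gt_d9]
  have hℓ0 : 0 < Real.log T := by linarith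
  have hquot : 0 < Real.log T / T := by positivity
  set x := (Real.log T / T) ^ (1 / 3 : ℝ) with hx
  have hx0 : 0 < x := Real.rpow_pos_of_pos hquot _
  have hx1 : x ≤ 1 := Real.rpow_le_one hquot.le
    ((div_le_one hT0).mpr ((Real.log_le_sub_one_of_pos hT0).trans (by linarith))) (by norm_num)
  have hx3 : T * x ^ 3 = Real.log T := by
    rw [hx, ← Real.rpow_natCast, ← Real.rpow_mul hquot.le]
    norm_num
    field_simp
  have hTx : (T : ℝ) * x = (T : ℝ) ^ (2 / 3 : ℝ) * Real.log T ^ (1 / 3 : ℝ) := by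
    rw [hx, Real.div_rpow hℓ0.le hT0.le, mul_div_assoc', mul_comm (T : ℝ), mul_div_assoc, mul_comm]
    congr 1
    rw [div_eq_iff (by positivity), ← Real.rpow_add hT0]
    norm_num
  have hS1 : 1 ≤ (T : ℝ) ^ (2 / 3 : ℝ) := Real.one_le_rpow (by linarith) (by norm_num)
  -- `ln T ≥ 1/2 ≥ 1/8`, so its cube root is at least `1/2`.
  have hS : (T : ℝ) ^ (2 / 3 : ℝ) ≤ 2 * (T * x) := by
    have h3 : 1 / 2 ≤ Real.log T ^ (1 / 3 : ℝ) := by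
      calc (1 / 2 : ℝ) = (1 / 8 : ℝ) ^ (1 / 3 : ℝ) := by
            rw [show (1 / 8 : ℝ) = (1 / 2) ^ (3 : ℝ) by norm_num, ← Real.rpow_mul (by norm_num)]
            norm_num
        _ ≤ _ := Real.rpow_le_rpow (by norm_num) (by linarith) (by norm_num)
    rw [hTx]
    nlinarith
  have hlog : Real.log (T + 1) ≤ 2 * Real.log T := by
    rw [← Real.log_rpow hT0]
    refine Real.log_le_log (by linarith) ?_
    rw [Real.rpow_two]
    nlinarith
  have hm0 : (0 : ℝ) < m := by exact_mod_cast (by omega : 0 < m)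
  have hK1 : (1 : ℝ) ≤ K := by exact_mod_cast hK
  have hd : 0 < √((K : ℝ) / Real.log T) * x := by positivity
  rw [mul_assoc (K : ℝ), ← hTx]
  exact (ActionBandit.regret_le hU hK hKm hx0 hd ht₀).trans
    (ActionBandit.regret_terms_le hK1 hm0 hT2 hx0 hx1 hℓ hx3 hc₁ h₁ h₂ (Nat.cast_nonneg _) hS1 hS
      hlog)
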